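/- **Conventions.** Manifolds are smooth, finite-dimensional, Hausdorff and second countable. A *vector bundle* is a complex vector bundle of finite rank with a hermitian structure and a connection respecting it; a *morphism* of vector bundles respects the hermitian structures and the connections (so it is fibrewise isometric); a *line bundle* is a vector bundle of rank $1$. With $\mathfrak u(1)=i\mathbb R$ identified with $\mathbb R$, $\mathrm{tr}(\mathrm{curv}(A))$ is a real 2-form. Pullbacks along evident projections, and the associativity isomorphisms of fibre products and tensor products, are not written. **Bundle gerbes.** A bundle gerbe $\mathcal G$ over a manifold $M$ consists of a surjective submersion $\pi:Y\to M$, a line bundle $L$ over $Y^{[2]}=Y\times_M Y$, a 2-form $C\in\Omega^2(Y)$ and an isomorphism $\mu:\pi_{12}^*L\otimes\pi_{23}^*L\to\pi_{13}^*L$ of line bundles over $Y^{[3]}$, such that $\mathrm{curv}(L)=\pi_2^*C-\pi_1^*C$ and $\mu$ is associative over $Y^{[4]}$. Contracting $\mu$ over the diagonal with $L^*$ gives the canonical trivialization $t_\mu:\Delta^*L\to 1$, $t_\mu(a)\,b=\mu(a\otimes b)$. **1-morphisms.** A 1-morphism $\mathcal A:\mathcal G_1\to\mathcal G_2$ consists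 of a surjective submersion $\zeta:Z\to P:=Y_1\times_M Y_2$, a vector bundle $A$ over $Z$ of some rank $n\ge 1$, and an isomorphism $\alpha:L_1\otimes\zeta_2^*A\to\zeta_1^*A\otimes L_2$ of vector bundles over $Z\times_M Z$, such that $\frac1n\mathrm{tr}(\mathrm{curv}(A))=C_2-C_1$ and, over $Z\times_M Z\times_M Z$, $$\zeta_{13}^*\alpha\circ(\mu_1\otimes\mathrm{id})=(\mathrm{id}\otimes\mu_2)\circ(\zeta_{12}^*\alpha\otimes\mathrm{id})\circ(\mathrm{id}\otimes\zeta_{23}^*\alpha).$$ It determines the isomorphism $\mathrm d_{\mathcal A}=(t_{\mu_1}\otimes\mathrm{id})\circ\alpha^{-1}\circ(\mathrm{id}\otimes t_{\mu_2}^{-1}):\zeta_1^*A\to\zeta_2^*A$ over $Z\times_P Z$. The identity $\mathrm{id}_{\mathcal G}$ is given by $Z=Y^{[2]}$, $\zeta=\mathrm{id}$, the line bundle $L$ and $\pi_{124}^*\mu^{-1}\circ\pi_{134}^*\mu$. The composition $\mathcal A'\circ\mathcal A$ is given by $Z\times_{Y_2}Z'\to Y_1\times_M Y_3$, $A\otimes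 A'$ and $(\mathrm{id}\otimes\alpha')\circ(\alpha\otimes\mathrm{id})$. **2-morphisms.** A 2-morphism $\beta:\mathcal A_1\Rightarrow\mathcal A_2$ is an equivalence class of triples $(W,\omega,\beta_W)$ of a manifold $W$, a surjective submersion $\omega:W\to Z_1\times_P Z_2$ and a morphism $\beta_W:A_1\to A_2$ of vector bundles over $W$ with $\alpha_2\circ(1\otimes\omega_2^*\beta_W)=(\omega_1^*\beta_W\otimes 1)\circ\alpha_1$ over $W\times_M W$. Two triples are equivalent if there is a manifold $X$ with surjective submersions to $W$ and $W'$, compatible with $\omega$ and $\omega'$, such that the pullbacks of $\beta_W$ and $\beta_{W'}$ to $X$ coincide. The identity $\mathrm{id}_{\mathcal A}$ is the class of $(Z\times_P Z,\mathrm{id},\mathrm d_{\mathcal A})$. The vertical composition $\beta'\bullet\beta$ is represented by $\beta_{W'}\circ\beta_W$ over $W\times_{Z_2}W'$. For $\beta_1:\mathcal A_1\Rightarrow\mathcal A_1'$ between 1-morphisms $\mathcal G_1\to\mathcal G_2$ and $\beta_2:\mathcal A_2\Rightarrow\mathcal A_2'$ between 1-morphisms $\mathcal G_2\to\mathcal G_3$,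 put $Q=Y_1\times_MY_3$ and let $\tilde Z\to Q$ and $\tilde Z'\to Q$ be the surjective submersions of $\mathcal A_2\circ\mathcal A_1$ and $\mathcal A_2'\circ\mathcal A_1'$; the horizontal composition $\beta_2\circ\beta_1$ is represented by $\mathrm d_{\mathcal A_2'\circ\mathcal A_1'}\circ(\beta_{W_1}\otimes\beta_{W_2})\circ\mathrm d_{\mathcal A_2\circ\mathcal A_1}$ over $\tilde Z\times_Q(W_1\times_{Y_2}W_2)\times_Q\tilde Z'$. A 2-isomorphism is a 2-morphism that is invertible under $\bullet$. For $\mathcal A:\mathcal G_1\to\mathcal G_2$ the 2-isomorphism $\lambda_{\mathcal A}:\mathcal A\circ\mathrm{id}_{\mathcal G_1}\Rightarrow\mathcal A$ is represented over $Z\times_{Y_2}Z$ by $(\mathrm{id}\otimes t_{\mu_2})\circ s^*\alpha:L_1\otimes\zeta_1^*A\to\zeta_2^*A$, where $s$ exchanges the two factors, and $\rho_{\mathcal A}:\mathrm{id}_{\mathcal G_2}\circ\mathcal A\Rightarrow\mathcal A$ is represented over $Z\times_{Y_1}Z$ by $(t_{\mu_1}\otimes\mathrm{id})\circ\alpha^{-1}:\zeta_1^*A\otimes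 L_2\to\zeta_2^*A$. **Invertibility.** $\mathcal A:\mathcal G_1\to\mathcal G_2$ is *invertible* if there are a 1-morphism $\mathcal A^{-1}:\mathcal G_2\to\mathcal G_1$ and 2-isomorphisms $i_l:\mathcal A^{-1}\circ\mathcal A\Rightarrow\mathrm{id}_{\mathcal G_1}$ and $i_r:\mathrm{id}_{\mathcal G_2}\Rightarrow\mathcal A\circ\mathcal A^{-1}$ such that $$\lambda_{\mathcal A}\bullet(\mathrm{id}_{\mathcal A}\circ i_l)\bullet(i_r\circ\mathrm{id}_{\mathcal A})=\rho_{\mathcal A}.$$ **Proposition.** Let $\mathcal G_1,\mathcal G_2$ be bundle gerbes over a smooth manifold $M$. A 1-morphism $\mathcal A:\mathcal G_1\to\mathcal G_2$ is invertible if and only if its vector bundle has rank $1$. -/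

import Mathlib

open scoped Manifold ContDiff Topology TensorProduct

universe u

namespace BundleGerbes

noncomputable section

/-- A smooth manifold: Hausdorff, second countable, without boundary, modelled on a
finite-dimensional real normed space `E`. -/
structure Mfd where
  E : Type
  [instE : NormedAddCommGroup E]
  [instE' : NormedSpace ℝ E]
  [instFin : FiniteDimensional ℝ E]
  carrier : Type u
  [instTop : TopologicalSpace carrier]
  [instT2 : T2Space carrier]
  [instSC : SecondCountableTopology carrier]
  [instCh : ChartedSpace E carrier]
  [instMfd : IsManifold 𝓘(ℝ, E) ∞ carrier]

namespace Mfd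

instance : CoeSort Mfd.{u} (Type u) := ⟨Mfd.carrier⟩

attribute [instance] instE instE' instFin instTop instT2 instSC instCh instMfd

/-- The model with corners of a manifold (without boundary). -/
abbrev I (X : Mfd.{u}) : ModelWithCorners ℝ X.E X.E := 𝓘(ℝ, X.E)

/-- The tangent space. -/
abbrev T (X : Mfd.{u}) (x : X) : Type := TangentSpace X.I x

instance (X : Mfd.{u}) : CompleteSpace X.E := FiniteDimensional.complete ℝ X.E

instance (X : Mfd.{u}) : IsManifold X.I 1 X := IsManifold.of_le (n := ∞) (by norm_num)

end Mfd

/-- Smooth maps between manifolds. -/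
structure SMap (X Y : Mfd.{u}) where
  toFun : X → Y
  smooth : ContMDiff X.I Y.I ∞ toFun

instance (X Y : Mfd.{u}) : CoeFun (SMap X Y) (fun _ => X → Y) := ⟨SMap.toFun⟩

/-- Surjective submersions: smooth surjective maps whose differential is onto at every point. -/
structure SSub (X Y : Mfd.{u}) extends SMap X Y where
  surj : Function.Surjective toFun
  subm : ∀ x, Function.Surjective (mfderiv X.I Y.I toFun x)

instance (X Y : Mfd.{u}) : CoeFun (SSub X Y) (fun _ => X → Y) := ⟨fun f => f.toFun⟩

/-- The model space of the fibres of a submersion. -/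
abbrev FibModel (Y M : Mfd.{u}) : Type :=
  EuclideanSpace ℝ (Fin (Module.finrank ℝ Y.E - Module.finrank ℝ M.E))

/-- A surjective linear map is, up to a linear isomorphism, a projection. -/
theorem exists_linear_split (V W : Type) [NormedAddCommGroup V] [NormedSpace ℝ V]
    [FiniteDimensional ℝ V] [NormedAddCommGroup W] [NormedSpace ℝ W] [FiniteDimensional ℝ W]
    (D : V →L[ℝ] W) (hD : Function.Surjective D) :
    ∃ p : V →L[ℝ] EuclideanSpace ℝ (Fin (Module.finrank ℝ V - Module.finrank ℝ W)),
      ∃ e : V ≃L[ℝ] W × EuclideanSpace ℝ (Fin (Module.finrank ℝ V - Module.finrank ℝ W)),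
        (e : V →L[ℝ] _) = D.prod p := by
  obtain ⟨q, hq⟩ := Submodule.exists_isCompl (LinearMap.ker (D : V →ₗ[ℝ] W))
  have hrank := LinearMap.finrank_range_add_finrank_ker (D : V →ₗ[ℝ] W)
  have hr : LinearMap.range (D : V →ₗ[ℝ] W) = ⊤ := LinearMap.range_eq_top.2 hD
  rw [hr, finrank_top] at hrank
  have hk : Module.finrank ℝ (LinearMap.ker (D : V →ₗ[ℝ] W)) =
      Module.finrank ℝ (EuclideanSpace ℝ (Fin (Module.finrank ℝ V - Module.finrank ℝ W))) := by
    rw [finrank_euclideanSpace_fin]; omega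
  let k := LinearEquiv.ofFinrankEq _ _ hk
  let p : V →ₗ[ℝ] EuclideanSpace ℝ (Fin (Module.finrank ℝ V - Module.finrank ℝ W)) :=
    k.toLinearMap ∘ₗ Submodule.projectionOnto _ q hq
  have hinj : Function.Injective ((D : V →ₗ[ℝ] W).prod p) := by
    rw [← LinearMap.ker_eq_bot, LinearMap.ker_eq_bot']
    intro v hv
    have h1 : (D : V →ₗ[ℝ] W) v = 0 := congrArg Prod.fst hv
    have h2 : k (Submodule.projectionOnto _ q hq v) = 0 := congrArg Prod.snd hv
    rw [LinearEquiv.map_eq_zero_iff] at h2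
    have h3 : Submodule.projectionOnto _ q hq v = ⟨v, h1⟩ :=
      Submodule.projectionOnto_apply_left hq ⟨v, h1⟩
    rw [h3] at h2
    exact congrArg Subtype.val h2
  have hdim : Module.finrank ℝ V =
      Module.finrank ℝ (W × EuclideanSpace ℝ (Fin (Module.finrank ℝ V - Module.finrank ℝ W))) := by
    rw [Module.finrank_prod, finrank_euclideanSpace_fin]; omega
  let e := (LinearEquiv.ofInjectiveOfFinrankEq _ hinj hdim).toContinuousLinearEquiv
  refine ⟨LinearMap.toContinuousLinearMap p, e, ?_⟩
  ext v <;> rfl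

/-- Local normal form of a submersion: around every point there is a chart in which the map is a
linear projection. -/
theorem SSub.exists_normal {Y M : Mfd.{u}} (g : SSub Y M) (y₀ : Y) :
    ∃ Φ : OpenPartialHomeomorph Y (M.E × FibModel Y M), y₀ ∈ Φ.source ∧
      (∀ y ∈ Φ.source, g y ∈ (chartAt M.E (g y₀)).source ∧
        (Φ y).1 = chartAt M.E (g y₀) (g y)) ∧
      ContMDiffOn Y.I 𝓘(ℝ, M.E × FibModel Y M) ∞ Φ Φ.source ∧
      ContMDiffOn 𝓘(ℝ, M.E × FibModel Y M) Y.I ∞ Φ.symm Φ.target := by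
  let ψ := chartAt Y.E y₀
  let φ := chartAt M.E (g y₀)
  let h₁ : Y.E → M.E := fun u => φ (g (ψ.symm u))
  obtain ⟨p, e, he⟩ := exists_linear_split Y.E M.E (mfderiv Y.I M.I g y₀) (g.subm y₀)
  let h : Y.E → M.E × FibModel Y M := fun u => (h₁ u, p u)
  let O₁ : Set Y.E := ψ.target ∩ ψ.symm ⁻¹' (g ⁻¹' φ.source)
  have hO₁ : IsOpen O₁ := ψ.symm.isOpen_inter_preimage
    (φ.open_source.preimage g.smooth.continuous)
  have hy₀ : ψ y₀ ∈ O₁ := by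
    refine ⟨ψ.map_source (mem_chart_source _ _), ?_⟩
    show g (ψ.symm (ψ y₀)) ∈ φ.source
    rw [ψ.left_inv (mem_chart_source _ _)]
    exact mem_chart_source _ _
  have hsm₁ : ContDiffOn ℝ ∞ h₁ O₁ := by
    rw [← contMDiffOn_iff_contDiffOn]
    have hφ : ContMDiffOn M.I 𝓘(ℝ, M.E) ∞ φ φ.source := contMDiffOn_chart
    have hψ : ContMDiffOn 𝓘(ℝ, Y.E) Y.I ∞ ψ.symm ψ.target := contMDiffOn_chart_symm
    exact hφ.comp (g.smooth.comp_contMDiffOn (hψ.mono Set.inter_subset_left))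
      (fun u hu => hu.2)
  have hsm : ContDiffOn ℝ ∞ h O₁ := hsm₁.prodMk p.contDiff.contDiffOn
  have hD : HasFDerivAt h₁ (mfderiv Y.I M.I g y₀) (ψ y₀) := by
    have h0 := ((g.smooth y₀).mdifferentiableAt (by simp)).hasMFDerivAt.2
    have h1 : HasFDerivWithinAt h₁ (mfderiv Y.I M.I g y₀) Set.univ (ψ y₀) := by
      simpa [writtenInExtChartAt, Function.comp_def] using h0
    exact hasFDerivWithinAt_univ.1 h1
  have hd : HasFDerivAt h (e : Y.E →L[ℝ] _) (ψ y₀) := by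
    rw [he]; exact hD.prodMk p.hasFDerivAt
  have hcd : ContDiffAt ℝ ∞ h (ψ y₀) := hsm.contDiffAt (hO₁.mem_nhds hy₀)
  let H := hcd.toOpenPartialHomeomorph h hd (by simp)
  have hH : ∀ u, H u = h u := fun u => rfl
  let O : Set Y.E := O₁ ∩ fderiv ℝ h ⁻¹' Set.range
    (ContinuousLinearEquiv.toContinuousLinearMap : (Y.E ≃L[ℝ] M.E × FibModel Y M) → _)
  have hO : IsOpen O := (hsm.continuousOn_fderiv_of_isOpen hO₁ (by simp)).isOpen_inter_preimage hO₁
    ContinuousLinearEquiv.isOpen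
  have hy₀O : ψ y₀ ∈ O := ⟨hy₀, by rw [Set.mem_preimage, hd.fderiv]; exact ⟨e, rfl⟩⟩
  let K := H.restr O
  have hKs : K.source = H.source ∩ O := by simp [K, hO.interior_eq]
  have hKsym : ContDiffOn ℝ ∞ K.symm K.target := by
    intro a ha
    have hs : K.symm a ∈ K.source := K.map_target ha
    rw [hKs] at hs
    obtain ⟨f', hf'⟩ := hs.2.2
    have hat : ContDiffAt ℝ ∞ h (K.symm a) := hsm.contDiffAt (hO₁.mem_nhds hs.2.1)
    have hder : HasFDerivAt h (f' : Y.E →L[ℝ] _) (K.symm a) := by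
      rw [hf']; exact (hat.differentiableAt (by simp)).hasFDerivAt
    exact (K.contDiffAt_symm ha hder hat).contDiffWithinAt
  have hψc : ContMDiffOn Y.I 𝓘(ℝ, Y.E) ∞ ψ ψ.source := contMDiffOn_chart
  have hψs : ContMDiffOn 𝓘(ℝ, Y.E) Y.I ∞ ψ.symm ψ.target := contMDiffOn_chart_symm
  refine ⟨ψ.trans K, ?_, ?_, ?_, ?_⟩
  · rw [OpenPartialHomeomorph.trans_source]
    refine ⟨mem_chart_source _ _, ?_⟩
    rw [Set.mem_preimage, hKs]
    exact ⟨hcd.mem_toOpenPartialHomeomorph_source hd (by simp), hy₀O⟩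
  · intro y hy
    rw [OpenPartialHomeomorph.trans_source] at hy
    have h2 := hy.2
    rw [Set.mem_preimage, hKs] at h2
    have h3 := h2.2.1.2
    have h4 : ψ.symm (ψ y) = y := ψ.left_inv hy.1
    rw [Set.mem_preimage, h4] at h3
    refine ⟨h3, ?_⟩
    show φ (g (ψ.symm (ψ y))) = _
    rw [h4]
  · have hK : ContMDiffOn 𝓘(ℝ, Y.E) 𝓘(ℝ, M.E × FibModel Y M) ∞ K K.source :=
      contMDiffOn_iff_contDiffOn.2 (hsm.mono (by rw [hKs]; exact fun u hu => hu.2.1))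
    rw [OpenPartialHomeomorph.trans_source]
    exact hK.comp (hψc.mono Set.inter_subset_left) (fun y hy => hy.2)
  · rw [OpenPartialHomeomorph.trans_target]
    exact hψs.comp ((contMDiffOn_iff_contDiffOn.2 hKsym).mono Set.inter_subset_left)
      (fun y hy => hy.2)


/-! ### Fibre products of surjective submersions -/

section FibProd

variable {X Y M : Mfd.{u}}

/-- The set underlying the fibre product. -/
abbrev FibSet (f : SSub X M) (g : SSub Y M) : Type u := {p : X × Y // f p.1 = g p.2}

variable (f : SSub X M) (g : SSub Y M)

/-- A chart of `Y` around `y₀` in which the submersion `g` is a linear projection. -/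
def normalChart (y₀ : Y) : OpenPartialHomeomorph Y (M.E × FibModel Y M) :=
  (g.exists_normal y₀).choose

theorem normalChart_spec (y₀ : Y) : y₀ ∈ (normalChart g y₀).source ∧
      (∀ y ∈ (normalChart g y₀).source, g y ∈ (chartAt M.E (g y₀)).source ∧
        (normalChart g y₀ y).1 = chartAt M.E (g y₀) (g y)) ∧
      ContMDiffOn Y.I 𝓘(ℝ, M.E × FibModel Y M) ∞ (normalChart g y₀) (normalChart g y₀).source ∧
      ContMDiffOn 𝓘(ℝ, M.E × FibModel Y M) Y.I ∞ (normalChart g y₀).symm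
        (normalChart g y₀).target :=
  (g.exists_normal y₀).choose_spec

/-- In charts `χ` of `X` and `φ` of `M`, the map `(u, w) ↦ (φ (f (χ⁻¹ u)), w)`. -/
def fibAux (p₀ : FibSet f g) (c : X.E × FibModel Y M) : M.E × FibModel Y M :=
  (chartAt M.E (g p₀.1.2) (f ((chartAt X.E p₀.1.1).symm c.1)), c.2)

/-- The target of the chart `fibChart` of the fibre product. -/
def fibTarget (p₀ : FibSet f g) : Set (X.E × FibModel Y M) :=
  {c | (c.1 ∈ (chartAt X.E p₀.1.1).target ∧
      f ((chartAt X.E p₀.1.1).symm c.1) ∈ (chartAt M.E (g p₀.1.2)).source) ∧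
      fibAux f g p₀ c ∈ (normalChart g p₀.1.2).target}

theorem fibAux_smooth (p₀ : FibSet f g) :
    ContMDiffOn 𝓘(ℝ, X.E × FibModel Y M) 𝓘(ℝ, M.E × FibModel Y M) ∞ (fibAux f g p₀)
      {c | c.1 ∈ (chartAt X.E p₀.1.1).target ∧
      f ((chartAt X.E p₀.1.1).symm c.1) ∈ (chartAt M.E (g p₀.1.2)).source} := by
  have hφ : ContMDiffOn M.I 𝓘(ℝ, M.E) ∞ (chartAt M.E (g p₀.1.2))
      (chartAt M.E (g p₀.1.2)).source := contMDiffOn_chart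
  have hχ : ContMDiffOn 𝓘(ℝ, X.E) X.I ∞ (chartAt X.E p₀.1.1).symm (chartAt X.E p₀.1.1).target :=
    contMDiffOn_chart_symm
  have h1 : ContMDiff 𝓘(ℝ, X.E × FibModel Y M) 𝓘(ℝ, X.E) ∞
      (Prod.fst : X.E × FibModel Y M → X.E) := contDiff_fst.contMDiff
  have h2 : ContMDiff 𝓘(ℝ, X.E × FibModel Y M) 𝓘(ℝ, FibModel Y M) ∞
      (Prod.snd : X.E × FibModel Y M → FibModel Y M) := contDiff_snd.contMDiff
  exact (hφ.comp (f.smooth.comp_contMDiffOn (hχ.comp h1.contMDiffOn (fun c hc => hc.1)))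
    (fun c hc => hc.2)).prodMk_space h2.contMDiffOn

theorem fibTarget_open (p₀ : FibSet f g) : IsOpen (fibTarget f g p₀) := by
  have h1 : IsOpen {c : X.E × FibModel Y M | c.1 ∈ (chartAt X.E p₀.1.1).target ∧
      f ((chartAt X.E p₀.1.1).symm c.1) ∈ (chartAt M.E (g p₀.1.2)).source} :=
    ((chartAt X.E p₀.1.1).symm.isOpen_inter_preimage
      ((chartAt M.E (g p₀.1.2)).open_source.preimage f.smooth.continuous)).preimage continuous_fst
  exact (fibAux_smooth f g p₀).continuousOn.isOpen_inter_preimage h1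
    (normalChart g p₀.1.2).open_target

theorem fib_eq (p₀ : FibSet f g) {c : X.E × FibModel Y M} (hc : c ∈ fibTarget f g p₀) :
    f ((chartAt X.E p₀.1.1).symm c.1) = g ((normalChart g p₀.1.2).symm (fibAux f g p₀ c)) := by
  have hs := (normalChart g p₀.1.2).map_target hc.2
  obtain ⟨h1, h2⟩ := (normalChart_spec g p₀.1.2).2.1 _ hs
  rw [(normalChart g p₀.1.2).right_inv hc.2] at h2
  exact (chartAt M.E (g p₀.1.2)).injOn hc.1.2 h1 h2

open Classical in
/-- The chart of the fibre product around a point, built from a chart of `X` and an adapted chart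
of `Y`. -/
def fibChart (p₀ : FibSet f g) : OpenPartialHomeomorph (FibSet f g) (X.E × FibModel Y M) where
  toFun p := (chartAt X.E p₀.1.1 p.1.1, (normalChart g p₀.1.2 p.1.2).2)
  invFun c := if h : f ((chartAt X.E p₀.1.1).symm c.1) =
      g ((normalChart g p₀.1.2).symm (fibAux f g p₀ c)) then
      ⟨((chartAt X.E p₀.1.1).symm c.1, (normalChart g p₀.1.2).symm (fibAux f g p₀ c)), h⟩ else p₀
  source := {p | p.1.1 ∈ (chartAt X.E p₀.1.1).source ∧ p.1.2 ∈ (normalChart g p₀.1.2).source}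
  target := fibTarget f g p₀
  map_source' := by
    rintro ⟨⟨x, y⟩, hxy⟩ ⟨hx, hy⟩
    obtain ⟨h1, h2⟩ := (normalChart_spec g p₀.1.2).2.1 _ hy
    have hx' := (chartAt X.E p₀.1.1).left_inv hx
    have hxy' : f x = g y := hxy
    dsimp only at hx hy hx' h1 h2
    have haux : fibAux f g p₀ (chartAt X.E p₀.1.1 x, (normalChart g p₀.1.2 y).2) =
        normalChart g p₀.1.2 y := by
      refine Prod.ext ?_ rfl
      simp only [fibAux]
      rw [hx', hxy', ← h2]
    refine ⟨⟨(chartAt X.E p₀.1.1).map_source hx, ?_⟩, ?_⟩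
    · dsimp only
      rw [hx', hxy']; exact h1
    · dsimp only
      rw [haux]; exact (normalChart g p₀.1.2).map_source hy
  map_target' := by
    intro c hc
    rw [dif_pos (fib_eq f g p₀ hc)]
    exact ⟨(chartAt X.E p₀.1.1).map_target hc.1.1, (normalChart g p₀.1.2).map_target hc.2⟩
  left_inv' := by
    rintro ⟨⟨x, y⟩, hxy⟩ ⟨hx, hy⟩
    obtain ⟨h1, h2⟩ := (normalChart_spec g p₀.1.2).2.1 _ hy
    have hx' := (chartAt X.E p₀.1.1).left_inv hx
    have hxy' : f x = g y := hxy
    dsimp only at hx hy hx' h1 h2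
    have haux : fibAux f g p₀ (chartAt X.E p₀.1.1 x, (normalChart g p₀.1.2 y).2) =
        normalChart g p₀.1.2 y := by
      refine Prod.ext ?_ rfl
      simp only [fibAux]
      rw [hx', hxy', ← h2]
    have hy' := (normalChart g p₀.1.2).left_inv hy
    have hh : f ((chartAt X.E p₀.1.1).symm (chartAt X.E p₀.1.1 x)) =
      g ((normalChart g p₀.1.2).symm
        (fibAux f g p₀ (chartAt X.E p₀.1.1 x, (normalChart g p₀.1.2 y).2))) := by
      rw [haux, hx', hy', hxy']
    rw [dif_pos hh]
    refine Subtype.ext (Prod.ext hx' ?_)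
    dsimp only
    rw [haux, hy']
  right_inv' := by
    intro c hc
    rw [dif_pos (fib_eq f g p₀ hc)]
    refine Prod.ext ((chartAt X.E p₀.1.1).right_inv hc.1.1) ?_
    dsimp only
    rw [(normalChart g p₀.1.2).right_inv hc.2]
    rfl
  open_source := ((chartAt X.E p₀.1.1).open_source.preimage
      (continuous_fst.comp continuous_subtype_val)).inter
    ((normalChart g p₀.1.2).open_source.preimage (continuous_snd.comp continuous_subtype_val))
  open_target := fibTarget_open f g p₀
  continuousOn_toFun := by
    refine ContinuousOn.prodMk ?_ ?_
    · exact (chartAt X.E p₀.1.1).continuousOn.comp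
        (continuous_fst.comp continuous_subtype_val).continuousOn (fun p hp => hp.1)
    · exact continuous_snd.comp_continuousOn ((normalChart g p₀.1.2).continuousOn.comp
        (continuous_snd.comp continuous_subtype_val).continuousOn (fun p hp => hp.2))
  continuousOn_invFun := by
    refine Topology.IsInducing.subtypeVal.continuousOn_iff.2 ?_
    have : ContinuousOn (fun c : X.E × FibModel Y M => ((chartAt X.E p₀.1.1).symm c.1,
        (normalChart g p₀.1.2).symm (fibAux f g p₀ c))) (fibTarget f g p₀) := by
      refine ContinuousOn.prodMk ?_ ?_
      · exact (chartAt X.E p₀.1.1).continuousOn_symm.comp continuous_fst.continuousOn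
          (fun c hc => hc.1.1)
      · exact (normalChart g p₀.1.2).continuousOn_symm.comp
          ((fibAux_smooth f g p₀).continuousOn.mono (fun c hc => hc.1)) (fun c hc => hc.2)
    refine this.congr fun c hc => ?_
    simp only [Function.comp]
    rw [dif_pos (fib_eq f g p₀ hc)]

theorem fibChart_symm_fst (p₀ : FibSet f g) {c : X.E × FibModel Y M}
    (hc : c ∈ (fibChart f g p₀).target) :
    ((fibChart f g p₀).symm c).1.1 = (chartAt X.E p₀.1.1).symm c.1 := by
  show ((fibChart f g p₀).toPartialEquiv.invFun c).1.1 = _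
  simp only [fibChart]
  rw [dif_pos (fib_eq f g p₀ hc)]

theorem fibChart_symm_snd (p₀ : FibSet f g) {c : X.E × FibModel Y M}
    (hc : c ∈ (fibChart f g p₀).target) :
    ((fibChart f g p₀).symm c).1.2 = (normalChart g p₀.1.2).symm (fibAux f g p₀ c) := by
  show ((fibChart f g p₀).toPartialEquiv.invFun c).1.2 = _
  simp only [fibChart]
  rw [dif_pos (fib_eq f g p₀ hc)]

theorem mem_fibChart_source (p₀ : FibSet f g) : p₀ ∈ (fibChart f g p₀).source :=
  ⟨mem_chart_source _ _, (normalChart_spec g p₀.1.2).1⟩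

instance fibChartedSpace : ChartedSpace (X.E × FibModel Y M) (FibSet f g) where
  atlas := Set.range (fibChart f g)
  chartAt := fibChart f g
  mem_chart_source := mem_fibChart_source f g
  chart_mem_atlas p := ⟨p, rfl⟩

theorem fibChart_symm_fst_smooth (p₀ : FibSet f g) :
    ContMDiffOn 𝓘(ℝ, X.E × FibModel Y M) X.I ∞ (fun c => ((fibChart f g p₀).symm c).1.1)
      (fibChart f g p₀).target := by
  have hχ : ContMDiffOn 𝓘(ℝ, X.E) X.I ∞ (chartAt X.E p₀.1.1).symm (chartAt X.E p₀.1.1).target :=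
    contMDiffOn_chart_symm
  have h1 : ContMDiff 𝓘(ℝ, X.E × FibModel Y M) 𝓘(ℝ, X.E) ∞
      (Prod.fst : X.E × FibModel Y M → X.E) := contDiff_fst.contMDiff
  exact (hχ.comp h1.contMDiffOn (fun c hc => hc.1.1)).congr
    (fun c hc => fibChart_symm_fst f g p₀ hc)

theorem fibChart_symm_snd_smooth (p₀ : FibSet f g) :
    ContMDiffOn 𝓘(ℝ, X.E × FibModel Y M) Y.I ∞ (fun c => ((fibChart f g p₀).symm c).1.2)
      (fibChart f g p₀).target := by
  exact ((normalChart_spec g p₀.1.2).2.2.2.comp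
    ((fibAux_smooth f g p₀).mono (fun c hc => hc.1)) (fun c hc => hc.2)).congr
    (fun c hc => fibChart_symm_snd f g p₀ hc)

theorem fib_isManifold :
    IsManifold 𝓘(ℝ, X.E × FibModel Y M) ∞ (FibSet f g) := by
  refine isManifold_of_contDiffOn _ _ _ ?_
  rintro _ _ ⟨p₀, rfl⟩ ⟨p₁, rfl⟩
  rw [← contMDiffOn_iff_contDiffOn]
  have hmono : ∀ c ∈ ((fibChart f g p₀).symm.trans (fibChart f g p₁)).source,
      c ∈ (fibChart f g p₀).target := fun c hc => hc.1
  have hχ : ContMDiffOn X.I 𝓘(ℝ, X.E) ∞ (chartAt X.E p₁.1.1) (chartAt X.E p₁.1.1).source :=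
    contMDiffOn_chart
  have h2 : ContMDiff 𝓘(ℝ, M.E × FibModel Y M) 𝓘(ℝ, FibModel Y M) ∞
      (Prod.snd : M.E × FibModel Y M → FibModel Y M) := contDiff_snd.contMDiff
  have hA : ContMDiffOn 𝓘(ℝ, X.E × FibModel Y M) 𝓘(ℝ, X.E × FibModel Y M) ∞
      ((fibChart f g p₀).symm.trans (fibChart f g p₁))
      ((fibChart f g p₀).symm.trans (fibChart f g p₁)).source :=
    (hχ.comp ((fibChart_symm_fst_smooth f g p₀).mono hmono) (fun c hc => hc.2.1)).prodMk_space
      (h2.comp_contMDiffOn ((normalChart_spec g p₁.1.2).2.2.1.comp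
        ((fibChart_symm_snd_smooth f g p₀).mono hmono) (fun c hc => hc.2.2)))
  simpa using hA

local instance fibIsManifoldInst :
    IsManifold 𝓘(ℝ, X.E × FibModel Y M) ∞ (FibSet f g) := fib_isManifold f g

theorem fibChart_smoothAt (p₀ : FibSet f g) :
    ContMDiffAt 𝓘(ℝ, X.E × FibModel Y M) 𝓘(ℝ, X.E × FibModel Y M) ∞ (fibChart f g p₀) p₀ :=
  (contMDiffOn_chart (I := 𝓘(ℝ, X.E × FibModel Y M)) (x := p₀)).contMDiffAt
    ((fibChart f g p₀).open_source.mem_nhds (mem_fibChart_source f g p₀))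

theorem fib_smooth_fst :
    ContMDiff 𝓘(ℝ, X.E × FibModel Y M) X.I ∞ (fun p : FibSet f g => p.1.1) := by
  intro p₀
  have h2 := ((fibChart_symm_fst_smooth f g p₀).contMDiffAt ((fibChart f g p₀).open_target.mem_nhds
    ((fibChart f g p₀).map_source (mem_fibChart_source f g p₀)))).comp p₀
    (fibChart_smoothAt f g p₀)
  refine h2.congr_of_eventuallyEq ?_
  filter_upwards [(fibChart f g p₀).open_source.mem_nhds (mem_fibChart_source f g p₀)] with p hp
  simp only [Function.comp]
  rw [(fibChart f g p₀).left_inv hp]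

theorem fib_smooth_snd :
    ContMDiff 𝓘(ℝ, X.E × FibModel Y M) Y.I ∞ (fun p : FibSet f g => p.1.2) := by
  intro p₀
  have h2 := ((fibChart_symm_snd_smooth f g p₀).contMDiffAt ((fibChart f g p₀).open_target.mem_nhds
    ((fibChart f g p₀).map_source (mem_fibChart_source f g p₀)))).comp p₀
    (fibChart_smoothAt f g p₀)
  refine h2.congr_of_eventuallyEq ?_
  filter_upwards [(fibChart f g p₀).open_source.mem_nhds (mem_fibChart_source f g p₀)] with p hp
  simp only [Function.comp]
  rw [(fibChart f g p₀).left_inv hp]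

theorem fib_smooth_mk {A : Mfd.{u}} {l : A → FibSet f g} {a : A}
    (h1 : ContMDiffAt A.I X.I ∞ (fun t => (l t).1.1) a)
    (h2 : ContMDiffAt A.I Y.I ∞ (fun t => (l t).1.2) a) :
    ContMDiffAt A.I 𝓘(ℝ, X.E × FibModel Y M) ∞ l a := by
  rw [contMDiffAt_iff_target]
  refine ⟨?_, ?_⟩
  · exact Topology.IsInducing.subtypeVal.continuousAt_iff.2
      (h1.continuousAt.prodMk h2.continuousAt)
  · have hχ : ContMDiffOn X.I 𝓘(ℝ, X.E) ∞ (chartAt X.E (l a).1.1) (chartAt X.E (l a).1.1).source :=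
      contMDiffOn_chart
    have h3 : ContMDiff 𝓘(ℝ, M.E × FibModel Y M) 𝓘(ℝ, FibModel Y M) ∞
        (Prod.snd : M.E × FibModel Y M → FibModel Y M) := contDiff_snd.contMDiff
    have hs := mem_fibChart_source f g (l a)
    exact ((hχ.contMDiffAt ((chartAt X.E (l a).1.1).open_source.mem_nhds hs.1)).comp a
        h1).prodMk_space
      ((h3 _).comp a (((normalChart_spec g (l a).1.2).2.2.1.contMDiffAt
        ((normalChart g (l a).1.2).open_source.mem_nhds hs.2)).comp a h2))

end FibProd

/-- The fibre product `X ×_M Y`: the set `{(x, y) | f x = g y}` with the subspace topology and the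
smooth structure for which maps into it are smooth iff both components are. -/
def Fib {X Y M : Mfd.{u}} (f : SSub X M) (g : SSub Y M) : Mfd.{u} where
  E := X.E × FibModel Y M
  carrier := FibSet f g
  instSC := TopologicalSpace.Subtype.secondCountableTopology {p : X × Y | f p.1 = g p.2}
  instMfd := fib_isManifold f g

/-- A submersion has a smooth local section through every point. -/
theorem SSub.exists_section {Y M : Mfd.{u}} (g : SSub Y M) (y₀ : Y) :
    ∃ s : M → Y, ContMDiffAt M.I Y.I ∞ s (g y₀) ∧ s (g y₀) = y₀ ∧
      ∀ᶠ m in 𝓝 (g y₀), g (s m) = m := by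
  obtain ⟨Φ, h0, h1, h2, h3⟩ := g.exists_normal y₀
  let φ := chartAt M.E (g y₀)
  let c : M → M.E × FibModel Y M := fun m => (φ m, (Φ y₀).2)
  have hc0 : c (g y₀) = Φ y₀ := Prod.ext (h1 y₀ h0).2.symm rfl
  have hφ : ContMDiffAt M.I 𝓘(ℝ, M.E) ∞ φ (g y₀) :=
    contMDiffOn_chart.contMDiffAt (φ.open_source.mem_nhds (mem_chart_source _ _))
  have hc : ContMDiffAt M.I 𝓘(ℝ, M.E × FibModel Y M) ∞ c (g y₀) :=
    hφ.prodMk_space contMDiffAt_const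
  have hT : Φ.target ∈ 𝓝 (c (g y₀)) := by
    rw [hc0]; exact Φ.open_target.mem_nhds (Φ.map_source h0)
  refine ⟨fun m => Φ.symm (c m), (h3.contMDiffAt hT).comp _ hc, ?_, ?_⟩
  · dsimp only
    rw [hc0, Φ.left_inv h0]
  · filter_upwards [hc.continuousAt.preimage_mem_nhds hT,
      φ.open_source.mem_nhds (mem_chart_source M.E (g y₀))] with m hm hm'
    obtain ⟨h4, h5⟩ := h1 _ (Φ.map_target hm)
    rw [Φ.right_inv hm] at h5
    exact (φ.injOn hm' h4 h5).symm

/-- A smooth map with smooth local sections through every point is a submersion. -/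
theorem submersion_of_section {Y M : Mfd.{u}} (g : SMap Y M) (y₀ : Y) (s : M → Y)
    (hs : ContMDiffAt M.I Y.I ∞ s (g y₀)) (h0 : s (g y₀) = y₀)
    (h1 : ∀ᶠ m in 𝓝 (g y₀), g (s m) = m) :
    Function.Surjective (mfderiv Y.I M.I g y₀) := by
  have hg : MDifferentiableAt Y.I M.I g (s (g y₀)) := (g.smooth _).mdifferentiableAt (by simp)
  have hc := mfderiv_comp (g y₀) hg (hs.mdifferentiableAt (by simp))
  have hid : mfderiv M.I M.I (g ∘ s) (g y₀) = ContinuousLinearMap.id ℝ (TangentSpace M.I (g y₀)) := by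
    rw [Filter.EventuallyEq.mfderiv_eq (f₁ := g ∘ s) (f := id) (by exact h1)]
    exact mfderiv_id
  intro v
  have : mfderiv Y.I M.I g (s (g y₀)) (mfderiv M.I Y.I s (g y₀) v) = v := by
    have := congrArg (fun L => L v) (hc.symm.trans hid)
    exact this
  rw [h0] at this
  exact ⟨_, this⟩

namespace SSub

variable {X Y Z M N : Mfd.{u}}

/-- The identity as a surjective submersion. -/
def id (X : Mfd.{u}) : SSub X X where
  toFun x := x
  smooth := contMDiff_id
  surj x := ⟨x, rfl⟩
  subm x := by
    have : mfderiv X.I X.I (fun x : X => x) x = ContinuousLinearMap.id ℝ (TangentSpace X.I x) :=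
      mfderiv_id
    rw [this]
    exact fun v => ⟨v, rfl⟩

/-- Composition of surjective submersions. -/
def comp (g : SSub Y Z) (f : SSub X Y) : SSub X Z where
  toFun x := g (f x)
  smooth := g.smooth.comp f.smooth
  surj := g.surj.comp f.surj
  subm x := by
    have : mfderiv X.I Z.I (fun x => g (f x)) x =
        (mfderiv Y.I Z.I g (f x)).comp (mfderiv X.I Y.I f x) :=
      mfderiv_comp x ((g.smooth _).mdifferentiableAt (by simp))
        ((f.smooth _).mdifferentiableAt (by simp))
    rw [this]
    exact (g.subm _).comp (f.subm x)

end SSub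

/-- Composition of smooth maps. -/
def SMap.comp {X Y Z : Mfd.{u}} (g : SMap Y Z) (f : SMap X Y) : SMap X Z where
  toFun x := g (f x)
  smooth := g.smooth.comp f.smooth

namespace Fib

variable {X Y M A : Mfd.{u}} {f : SSub X M} {g : SSub Y M}

/-- The point `(x, y)` of the fibre product. -/
def pt (x : X) (y : Y) (h : f x = g y) : Fib f g := ⟨(x, y), h⟩

variable (f g)

/-- The first projection. -/
def pr₁ : SMap (Fib f g) X := ⟨fun p => p.1.1, fib_smooth_fst f g⟩

/-- The second projection. -/
def pr₂ : SMap (Fib f g) Y := ⟨fun p => p.1.2, fib_smooth_snd f g⟩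

/-- The fibre product square commutes. -/
theorem sq (p : Fib f g) : f (pr₁ f g p) = g (pr₂ f g p) := p.2

variable {f g}

theorem smoothAt_of {l : A → Fib f g} {a : A}
    (h1 : ContMDiffAt A.I X.I ∞ (fun t => pr₁ f g (l t)) a)
    (h2 : ContMDiffAt A.I Y.I ∞ (fun t => pr₂ f g (l t)) a) :
    ContMDiffAt A.I (Fib f g).I ∞ l a :=
  fib_smooth_mk f g h1 h2

/-- The map into the fibre product with given components. -/
def lift (a : SMap A X) (b : SMap A Y) (h : ∀ t, f (a t) = g (b t)) : SMap A (Fib f g) where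
  toFun t := pt (a t) (b t) (h t)
  smooth t := smoothAt_of (a.smooth t) (b.smooth t)

open Classical in
/-- Local version of `lift`. -/
theorem exists_local_lift (p₀ : Fib f g) (t₀ : A) {a : A → X} {b : A → Y}
    (ha : ContMDiffAt A.I X.I ∞ a t₀) (hb : ContMDiffAt A.I Y.I ∞ b t₀)
    (ha₀ : a t₀ = pr₁ f g p₀) (hb₀ : b t₀ = pr₂ f g p₀) (h : ∀ᶠ t in 𝓝 t₀, f (a t) = g (b t)) :
    ∃ l : A → Fib f g, ContMDiffAt A.I (Fib f g).I ∞ l t₀ ∧ l t₀ = p₀ ∧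
      ∀ᶠ t in 𝓝 t₀, pr₁ f g (l t) = a t ∧ pr₂ f g (l t) = b t := by
  let l : A → Fib f g := fun t => if h : f (a t) = g (b t) then pt (a t) (b t) h else p₀
  have hl : ∀ᶠ t in 𝓝 t₀, pr₁ f g (l t) = a t ∧ pr₂ f g (l t) = b t := by
    filter_upwards [h] with t ht
    have : l t = pt (a t) (b t) ht := dif_pos ht
    rw [this]
    exact ⟨rfl, rfl⟩
  refine ⟨l, smoothAt_of (ha.congr_of_eventuallyEq (hl.mono fun t ht => ht.1))
    (hb.congr_of_eventuallyEq (hl.mono fun t ht => ht.2)), ?_, hl⟩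
  have h0 := hl.self_of_nhds
  exact Subtype.ext (Prod.ext (h0.1.trans ha₀) (h0.2.trans hb₀))

variable (f g)

/-- The first projection, as a surjective submersion. -/
def fst : SSub (Fib f g) X where
  toSMap := pr₁ f g
  surj x := by
    obtain ⟨y, hy⟩ := g.surj (f x)
    exact ⟨pt x y hy.symm, rfl⟩
  subm p := by
    obtain ⟨s, hs, hs0, hs1⟩ := g.exists_section (pr₂ f g p)
    rw [← sq] at hs hs0 hs1
    have hf : ContMDiffAt X.I M.I ∞ f (pr₁ f g p) := f.smooth _
    obtain ⟨l, hl, hl0, hl1⟩ := exists_local_lift (A := X) p (pr₁ f g p) (a := fun x => x)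
      (b := fun x => s (f x)) contMDiffAt_id (hs.comp _ hf) rfl hs0
      ((hf.continuousAt.eventually hs1).mono fun x hx => hx.symm)
    exact submersion_of_section (pr₁ f g) p l hl hl0 (hl1.mono fun x hx => hx.1)

/-- The second projection, as a surjective submersion. -/
def snd : SSub (Fib f g) Y where
  toSMap := pr₂ f g
  surj y := by
    obtain ⟨x, hx⟩ := f.surj (g y)
    exact ⟨pt x y hx, rfl⟩
  subm p := by
    obtain ⟨s, hs, hs0, hs1⟩ := f.exists_section (pr₁ f g p)
    rw [sq] at hs hs0 hs1
    have hg : ContMDiffAt Y.I M.I ∞ g (pr₂ f g p) := g.smooth _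
    obtain ⟨l, hl, hl0, hl1⟩ := exists_local_lift (A := Y) p (pr₂ f g p) (b := fun x => x)
      (a := fun x => s (g x)) (hs.comp _ hg) contMDiffAt_id hs0 rfl
      (hg.continuousAt.eventually hs1)
    exact submersion_of_section (pr₂ f g) p l hl hl0 (hl1.mono fun x hx => hx.2)

variable {f g}

/-- For surjective submersions `a : V → X ×_M Y` and `b : W → Y ×_M Z`, the induced surjective
submersion `V ×_Y W → X ×_M Z`. -/
def join {V W Z : Mfd.{u}} {k : SSub Z M} (a : SSub V (Fib f g)) (b : SSub W (Fib g k)) :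
    SSub (Fib ((snd f g).comp a) ((fst g k).comp b)) (Fib f k) where
  toSMap := lift (((pr₁ f g).comp a.toSMap).comp (pr₁ _ _)) (((pr₂ g k).comp b.toSMap).comp (pr₂ _ _))
    (fun p => (sq f g (a (pr₁ _ _ p))).trans ((congrArg g p.2).trans
      (sq g k (b (pr₂ _ _ p)))))
  surj q := by
    obtain ⟨y, hy⟩ := g.surj (f (pr₁ f k q))
    obtain ⟨v, hv⟩ := a.surj (pt (pr₁ f k q) y hy.symm)
    obtain ⟨w, hw⟩ := b.surj (pt y (pr₂ f k q) (hy.trans (sq f k q)))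
    refine ⟨pt v w ?_, ?_⟩
    · exact (congrArg (pr₂ f g) hv).trans (congrArg (pr₁ g k) hw).symm
    · exact Subtype.ext (Prod.ext (congrArg (pr₁ f g) hv) (congrArg (pr₂ g k) hw))
  subm p := by
    let v := pr₁ _ _ p
    let w := pr₂ _ _ p
    have hvw : pr₂ f g (a v) = pr₁ g k (b w) := sq _ _ p
    set J : SMap (Fib ((snd f g).comp a) ((fst g k).comp b)) (Fib f k) :=
      lift (((pr₁ f g).comp a.toSMap).comp (pr₁ _ _)) (((pr₂ g k).comp b.toSMap).comp (pr₂ _ _))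
        (fun p => (sq f g (a (pr₁ _ _ p))).trans ((congrArg g p.2).trans
          (sq g k (b (pr₂ _ _ p))))) with hJ
    let q : Fib f k := J p
    have hq1 : pr₁ f k q = pr₁ f g (a v) := rfl
    have hq2 : pr₂ f k q = pr₂ g k (b w) := rfl
    -- a local section `q ↦ y` of the projection to `M`
    obtain ⟨s, hs, hs0, hs1⟩ := g.exists_section (pr₂ f g (a v))
    have hm : g (pr₂ f g (a v)) = f (pr₁ f k q) := (sq f g (a v)).symm
    rw [hm] at hs hs0 hs1
    have hf : ContMDiffAt (Fib f k).I M.I ∞ (fun q => f (pr₁ f k q)) q :=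
      (f.smooth _).comp q ((pr₁ f k).smooth q)
    have hy : ContMDiffAt (Fib f k).I Y.I ∞ (fun q => s (f (pr₁ f k q))) q := hs.comp q hf
    have hys : ∀ᶠ q' in 𝓝 q, g (s (f (pr₁ f k q'))) = f (pr₁ f k q') :=
      hf.continuousAt.eventually hs1
    obtain ⟨l₁, hl₁, hl₁0, hl₁1⟩ := exists_local_lift (A := Fib f k) (a v) q
      ((pr₁ f k).smooth q) hy hq1 hs0 (hys.mono fun x hx => hx.symm)
    obtain ⟨l₂, hl₂, hl₂0, hl₂1⟩ := exists_local_lift (A := Fib f k) (b w) q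
      hy ((pr₂ f k).smooth q) (hs0.trans hvw) hq2
      (hys.mono fun x hx => hx.trans (sq f k x))
    obtain ⟨sa, hsa, hsa0, hsa1⟩ := a.exists_section v
    obtain ⟨sb, hsb, hsb0, hsb1⟩ := b.exists_section w
    rw [← hl₁0] at hsa hsa0 hsa1
    rw [← hl₂0] at hsb hsb0 hsb1
    have ha1 := hl₁.continuousAt.eventually hsa1
    have hb1 := hl₂.continuousAt.eventually hsb1
    obtain ⟨l, hl, hl0, hl1⟩ := exists_local_lift (A := Fib f k) p q
      (hsa.comp q hl₁) (hsb.comp q hl₂) hsa0 hsb0 (by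
        filter_upwards [ha1, hb1, hl₁1, hl₂1] with x h1 h2 h3 h4
        exact (congrArg (pr₂ f g) h1).trans (h3.2.trans (h4.1.symm.trans
          (congrArg (pr₁ g k) h2).symm)))
    refine submersion_of_section J p l hl hl0 ?_
    filter_upwards [ha1, hb1, hl₁1, hl₂1, hl1] with x h1 h2 h3 h4 h5
    refine Subtype.ext (Prod.ext ?_ ?_)
    · exact (congrArg (fun z => pr₁ f g (a z)) h5.1).trans ((congrArg (pr₁ f g) h1).trans h3.1)
    · exact (congrArg (fun z => pr₂ g k (b z)) h5.2).trans ((congrArg (pr₂ g k) h2).trans h4.2)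

end Fib

/-- The differential of a complex-valued function. -/
def dFun {X : Mfd.{u}} (m : X → ℂ) (x : X) : X.T x →L[ℝ] ℂ := mfderiv X.I 𝓘(ℝ, ℂ) m x

/-! ### Hermitian vector bundles with connection -/

/-- The data of a hermitian vector bundle with connection over `X`, given by local frames.
* `fib x` is the fibre over `x`, a complex inner product space;
* around every point `p` there is a domain `dom p` with an orthonormal frame `frame p` over it
  (the values of `frame p` outside of `dom p` play no role);
* `conn p` is the matrix of connection 1-forms with respect to that frame, that is
  `∇ (e b) = ∑ a, conn p a b • e a` for `e = frame p`. -/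
structure PreBundle (X : Mfd.{u}) where
  r : Type
  [fintype : Fintype r]
  [deceq : DecidableEq r]
  fib : X → Type u
  [nacg : ∀ x, NormedAddCommGroup (fib x)]
  [ips : ∀ x, InnerProductSpace ℂ (fib x)]
  dom : X → Set X
  frame : X → ∀ x, OrthonormalBasis r ℂ (fib x)
  conn : X → r → r → ∀ x, X.T x →L[ℝ] ℂ

namespace PreBundle

attribute [instance] fintype deceq nacg ips

/-- The matrix entry `(a, b)` of a fibrewise linear map `φ : E → F`, with respect to the frame of `E`
around `p` and the frame of `F` around `q`. -/
def coef {X : Mfd.{u}} (E F : PreBundle X) (φ : ∀ x, E.fib x →ₗ[ℂ] F.fib x) (p q : X)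
    (a : F.r) (b : E.r) (x : X) : ℂ :=
  inner ℂ (F.frame q x a) (φ x (E.frame p x b))

/-- A family `φ` of linear maps between the fibres is smooth and respects the connections:
its matrix `m` in local frames is smooth and satisfies `dm + ω_F m = m ω_E`.
(Respecting the hermitian structures is imposed separately, by using isometries.) -/
structure IsHom {X : Mfd.{u}} (E F : PreBundle X) (φ : ∀ x, E.fib x →ₗ[ℂ] F.fib x) : Prop where
  smooth : ∀ p q a b, ContMDiffOn X.I 𝓘(ℝ, ℂ) ∞ (coef E F φ p q a b) (E.dom p ∩ F.dom q)
  parallel : ∀ p q a b, ∀ x ∈ E.dom p ∩ F.dom q, ∀ v : X.T x,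
    dFun (coef E F φ p q a b) x v +
      ∑ k, F.conn q a k x v * coef E F φ p q k b x =
      ∑ k, coef E F φ p q a k x * E.conn p k b x v

end PreBundle

/-- A complex vector bundle of finite rank with a hermitian structure and a connection respecting it:
the frames are defined over open sets covering `X`, the connection 1-forms are smooth (as functions
on the tangent bundle) and skew-hermitian, and the transition functions between the frames are
smooth and intertwine the connection forms (`compat`). -/
structure HBundle (X : Mfd.{u}) extends PreBundle X where
  isOpen : ∀ p, IsOpen (dom p)
  mem : ∀ p, p ∈ dom p
  conn_smooth : ∀ p a b, ContMDiffOn X.I.tangent 𝓘(ℝ, ℂ) ∞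
    (fun w : TangentBundle X.I X => (conn p a b w.1 w.2 : ℂ)) {w | w.1 ∈ dom p}
  conn_skew : ∀ p a b, ∀ x ∈ dom p, ∀ v, conn p b a x v = -(starRingEnd ℂ) (conn p a b x v)
  compat : PreBundle.IsHom toPreBundle toPreBundle (fun _ => LinearMap.id)

namespace PreBundle

variable {X Y : Mfd.{u}}

/-- The pullback of the data along a smooth map. -/
@[reducible] def pull (E : PreBundle Y) (f : SMap X Y) : PreBundle X where
  r := E.r
  fib x := E.fib (f x)
  dom p := f ⁻¹' E.dom (f p)
  frame p x := E.frame (f p) (f x)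
  conn p a b x := (E.conn (f p) a b (f x)).comp (mfderiv X.I Y.I f x)

/-- The tensor product, with `∇ (s ⊗ t) = ∇ s ⊗ t + s ⊗ ∇ t`. -/
@[reducible] def tensor (E F : PreBundle X) : PreBundle X where
  r := E.r × F.r
  fib x := E.fib x ⊗[ℂ] F.fib x
  dom p := E.dom p ∩ F.dom p
  frame p x := (E.frame p x).tensorProduct (F.frame p x)
  conn p a b x := (if a.2 = b.2 then E.conn p a.1 b.1 x else 0) +
    (if a.1 = b.1 then F.conn p a.2 b.2 x else 0)

theorem IsHom.pull {E F : PreBundle Y} {φ : ∀ y, E.fib y →ₗ[ℂ] F.fib y} (h : IsHom E F φ)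
    (hE : ∀ p, IsOpen (E.dom p)) (hF : ∀ p, IsOpen (F.dom p))
    (f : SMap X Y) : IsHom (E.pull f) (F.pull f) (fun x => φ (f x)) where
  smooth p q a b := (h.smooth (f p) (f q) a b).comp f.smooth.contMDiffOn (fun x hx => hx)
  parallel p q a b x hx v := by
    have hd : MDifferentiableAt Y.I 𝓘(ℝ, ℂ) (coef E F φ (f p) (f q) a b) (f x) :=
      ((h.smooth (f p) (f q) a b).contMDiffAt
        (((hE _).inter (hF _)).mem_nhds hx)).mdifferentiableAt (by simp)
    have hc : dFun (coef (E.pull f) (F.pull f) (fun x => φ (f x)) p q a b) x =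
        (dFun (coef E F φ (f p) (f q) a b) (f x)).comp (mfderiv X.I Y.I f x) :=
      mfderiv_comp x hd ((f.smooth x).mdifferentiableAt (by simp))
    rw [hc]
    exact h.parallel (f p) (f q) a b (f x) hx (mfderiv X.I Y.I f x v)

theorem coef_tensor {E F E' F' : PreBundle X} (φ : ∀ x, E.fib x →ₗ[ℂ] E'.fib x)
    (ψ : ∀ x, F.fib x →ₗ[ℂ] F'.fib x) (p q : X) (a : E'.r × F'.r) (b : E.r × F.r) (x : X) :
    coef (E.tensor F) (E'.tensor F') (fun x => TensorProduct.map (φ x) (ψ x)) p q a b x =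
      coef E E' φ p q a.1 b.1 x * coef F F' ψ p q a.2 b.2 x := by
  simp [coef, OrthonormalBasis.tensorProduct_apply']

theorem IsHom.tensor {E F E' F' : PreBundle X} {φ : ∀ x, E.fib x →ₗ[ℂ] E'.fib x}
    {ψ : ∀ x, F.fib x →ₗ[ℂ] F'.fib x} (hφ : IsHom E E' φ) (hψ : IsHom F F' ψ)
    (hE : ∀ p, IsOpen (E.dom p)) (hF : ∀ p, IsOpen (F.dom p))
    (hE' : ∀ p, IsOpen (E'.dom p)) (hF' : ∀ p, IsOpen (F'.dom p)) :
    IsHom (E.tensor F) (E'.tensor F') (fun x => TensorProduct.map (φ x) (ψ x)) where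
  smooth p q a b := by
    have h1 := (hφ.smooth p q a.1 b.1).mono (t := E.dom p ∩ F.dom p ∩ (E'.dom q ∩ F'.dom q))
      (fun x hx => ⟨hx.1.1, hx.2.1⟩)
    have h2 := (hψ.smooth p q a.2 b.2).mono (t := E.dom p ∩ F.dom p ∩ (E'.dom q ∩ F'.dom q))
      (fun x hx => ⟨hx.1.2, hx.2.2⟩)
    have hm : ContDiff ℝ ∞ (fun c : ℂ × ℂ => c.1 * c.2) := contDiff_fst.mul contDiff_snd
    have h3 := hm.contMDiff.comp_contMDiffOn (h1.prodMk_space h2)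
    exact h3.congr fun x _ => coef_tensor φ ψ p q a b x
  parallel p q a b x hx v := by
    have hf : MDifferentiableAt X.I 𝓘(ℝ, ℂ) (coef E E' φ p q a.1 b.1) x :=
      ((hφ.smooth p q a.1 b.1).contMDiffAt (((hE _).inter (hE' _)).mem_nhds
        ⟨hx.1.1, hx.2.1⟩)).mdifferentiableAt (by simp)
    have hg : MDifferentiableAt X.I 𝓘(ℝ, ℂ) (coef F F' ψ p q a.2 b.2) x :=
      ((hψ.smooth p q a.2 b.2).contMDiffAt (((hF _).inter (hF' _)).mem_nhds
        ⟨hx.1.2, hx.2.2⟩)).mdifferentiableAt (by simp)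
    have hfun : coef (E.tensor F) (E'.tensor F') (fun x => TensorProduct.map (φ x) (ψ x)) p q a b =
        coef E E' φ p q a.1 b.1 * coef F F' ψ p q a.2 b.2 :=
      funext fun x => coef_tensor φ ψ p q a b x
    have hder : dFun (coef (E.tensor F) (E'.tensor F')
        (fun x => TensorProduct.map (φ x) (ψ x)) p q a b) x v =
        coef E E' φ p q a.1 b.1 x * dFun (coef F F' ψ p q a.2 b.2) x v +
        coef F F' ψ p q a.2 b.2 x * dFun (coef E E' φ p q a.1 b.1) x v := by
      rw [hfun]
      have := (hf.hasMFDerivAt.mul hg.hasMFDerivAt).mfderiv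
      exact congrArg (fun L => L v) this
    have e1 := hφ.parallel p q a.1 b.1 x ⟨hx.1.1, hx.2.1⟩ v
    have e2 := hψ.parallel p q a.2 b.2 x ⟨hx.1.2, hx.2.2⟩ v
    rw [hder]
    simp only [coef_tensor, Fintype.sum_prod_type]
    have s1 : ∑ k : E'.r, ∑ l : F'.r, (((if a.2 = l then E'.conn q a.1 k x else 0) +
        (if a.1 = k then F'.conn q a.2 l x else 0) : X.T x →L[ℝ] ℂ) v : ℂ) *
          (coef E E' φ p q k b.1 x * coef F F' ψ p q l b.2 x) =
        (∑ k, E'.conn q a.1 k x v * coef E E' φ p q k b.1 x) * coef F F' ψ p q a.2 b.2 x +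
        coef E E' φ p q a.1 b.1 x * ∑ l, F'.conn q a.2 l x v * coef F F' ψ p q l b.2 x := by
      have hs : ∀ k l, (((if a.2 = l then E'.conn q a.1 k x else 0) +
          (if a.1 = k then F'.conn q a.2 l x else 0) : X.T x →L[ℝ] ℂ) v : ℂ) =
          (if a.2 = l then E'.conn q a.1 k x v else 0) +
          (if a.1 = k then F'.conn q a.2 l x v else 0) := by
        intro k l; split_ifs <;> simp
      simp only [hs, add_mul, Finset.sum_add_distrib, ite_mul, zero_mul, Finset.sum_ite_eq,
        Finset.mem_univ, if_true]
      congr 1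
      · rw [Finset.sum_mul]
        exact Finset.sum_congr rfl fun k _ => by ring
      · rw [Finset.sum_comm, Finset.mul_sum]
        simp only [Finset.sum_ite_eq, Finset.mem_univ, if_true]
        exact Finset.sum_congr rfl fun k _ => by ring
    have s2 : ∑ k : E.r, ∑ l : F.r, (coef E E' φ p q a.1 k x * coef F F' ψ p q a.2 l x) *
        (((if l = b.2 then E.conn p k b.1 x else 0) +
        (if k = b.1 then F.conn p l b.2 x else 0) : X.T x →L[ℝ] ℂ) v : ℂ) =
        (∑ k, coef E E' φ p q a.1 k x * E.conn p k b.1 x v) * coef F F' ψ p q a.2 b.2 x +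
        coef E E' φ p q a.1 b.1 x * ∑ l, coef F F' ψ p q a.2 l x * F.conn p l b.2 x v := by
      have hs : ∀ k l, (((if l = b.2 then E.conn p k b.1 x else 0) +
          (if k = b.1 then F.conn p l b.2 x else 0) : X.T x →L[ℝ] ℂ) v : ℂ) =
          (if l = b.2 then E.conn p k b.1 x v else 0) +
          (if k = b.1 then F.conn p l b.2 x v else 0) := by
        intro k l; split_ifs <;> simp
      simp only [hs, mul_add, Finset.sum_add_distrib, mul_ite, mul_zero, Finset.sum_ite_eq',
        Finset.mem_univ, if_true]
      congr 1
      · rw [Finset.sum_mul]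
        exact Finset.sum_congr rfl fun k _ => by ring
      · rw [Finset.sum_comm, Finset.mul_sum]
        simp only [Finset.sum_ite_eq', Finset.mem_univ, if_true]
        exact Finset.sum_congr rfl fun k _ => by ring
    rw [s1, s2, ← e1, ← e2]
    ring

end PreBundle

namespace HBundle

variable {X Y : Mfd.{u}}

/-- The pullback of a bundle along a smooth map. -/
@[reducible] def pull (E : HBundle Y) (f : SMap X Y) : HBundle X where
  toPreBundle := E.toPreBundle.pull f
  isOpen p := (E.isOpen _).preimage f.smooth.continuous
  mem p := E.mem _
  conn_smooth p a b := by
    have ht : ContMDiff X.I.tangent Y.I.tangent ∞ (tangentMap X.I Y.I f) :=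
      f.smooth.contMDiff_tangentMap (by simp)
    exact (E.conn_smooth (f p) a b).comp ht.contMDiffOn (fun w hw => hw)
  conn_skew p a b x hx v := E.conn_skew (f p) a b (f x) hx (mfderiv X.I Y.I f x v)
  compat := E.compat.pull E.isOpen E.isOpen f

/-- The tensor product of two bundles, with the tensor product connection. -/
@[reducible] def tensor (E F : HBundle X) : HBundle X where
  toPreBundle := E.toPreBundle.tensor F.toPreBundle
  isOpen p := (E.isOpen p).inter (F.isOpen p)
  mem p := ⟨E.mem p, F.mem p⟩
  conn_smooth p a b := by
    have h1 := (E.conn_smooth p a.1 b.1).mono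
      (t := {w : TangentBundle X.I X | w.1 ∈ E.dom p ∩ F.dom p}) (fun w hw => hw.1)
    have h2 := (F.conn_smooth p a.2 b.2).mono
      (t := {w : TangentBundle X.I X | w.1 ∈ E.dom p ∩ F.dom p}) (fun w hw => hw.2)
    have h0 : ContMDiffOn X.I.tangent 𝓘(ℝ, ℂ) ∞ (fun _ : TangentBundle X.I X => (0 : ℂ))
      {w : TangentBundle X.I X | w.1 ∈ E.dom p ∩ F.dom p} := contMDiffOn_const
    have hadd : ContDiff ℝ ∞ (fun c : ℂ × ℂ => c.1 + c.2) := contDiff_fst.add contDiff_snd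
    have key : ∀ (P : Prop) [Decidable P] (k : TangentBundle X.I X → ℂ)
        (_ : ContMDiffOn X.I.tangent 𝓘(ℝ, ℂ) ∞ k {w | w.1 ∈ E.dom p ∩ F.dom p}),
        ContMDiffOn X.I.tangent 𝓘(ℝ, ℂ) ∞ (fun w => if P then k w else 0)
          {w | w.1 ∈ E.dom p ∩ F.dom p} := by
      intro P _ k hk
      by_cases hP : P
      · simpa only [if_pos hP] using hk
      · simpa only [if_neg hP] using h0
    have h3 := hadd.contMDiff.comp_contMDiffOn
      ((key (a.2 = b.2) _ h1).prodMk_space (key (a.1 = b.1) _ h2))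
    refine h3.congr fun w _ => ?_
    simp only [Function.comp]
    split_ifs <;> simp
  conn_skew p a b x hx v := by
    have h1 := E.conn_skew p a.1 b.1 x hx.1 v
    have h2 := F.conn_skew p a.2 b.2 x hx.2 v
    simp only [eq_comm (a := b.2), eq_comm (a := b.1)]
    split_ifs <;> simp [h1, h2]; ring
  compat := by
    have := E.compat.tensor F.compat E.isOpen F.isOpen E.isOpen F.isOpen
    simpa only [TensorProduct.map_id] using this

end HBundle

/-- The identification of the fibres over equal points. -/
def PreBundle.cast {X : Mfd.{u}} (E : PreBundle X) {x y : X} (h : x = y) :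
    E.fib x ≃ₗᵢ[ℂ] E.fib y :=
  h ▸ LinearIsometryEquiv.refl ℂ (E.fib x)

/-! ### Differential forms and curvature -/

/-- A smooth real 2-form. -/
structure TwoForm (X : Mfd.{u}) where
  toFun : ∀ x : X, X.T x →L[ℝ] X.T x →L[ℝ] ℝ
  alt : ∀ x v, toFun x v v = 0
  smooth : ContMDiff X.I (X.I.prod 𝓘(ℝ, X.E →L[ℝ] X.E →L[ℝ] ℝ)) ∞
    (fun x => Bundle.TotalSpace.mk' (X.E →L[ℝ] X.E →L[ℝ] ℝ)
      (E := fun x : X => X.T x →L[ℝ] X.T x →L[ℝ] ℝ) x (toFun x))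

/-- The pullback of a 2-form along a smooth map, evaluated on two tangent vectors. -/
def TwoForm.pullAt {X Y : Mfd.{u}} (C : TwoForm Y) (f : SMap X Y) (x : X) (v w : X.T x) : ℝ :=
  C.toFun (f x) (mfderiv X.I Y.I f x v) (mfderiv X.I Y.I f x w)

/-- The exterior derivative `dθ (v, w)` of a complex-valued 1-form `θ`, computed in the preferred
chart around `x`. -/
def extD {X : Mfd.{u}} (θ : ∀ x, X.T x →L[ℝ] ℂ) (x : X) (v w : X.T x) : ℂ :=
  let η : X.E → X.E →L[ℝ] ℂ := fun c =>
    (θ ((extChartAt X.I x).symm c)).comp (mfderiv 𝓘(ℝ, X.E) X.I (extChartAt X.I x).symm c)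
  let v' : X.E := mfderiv X.I 𝓘(ℝ, X.E) (extChartAt X.I x) x v
  let w' : X.E := mfderiv X.I 𝓘(ℝ, X.E) (extChartAt X.I x) x w
  fderiv ℝ η (extChartAt X.I x x) v' w' - fderiv ℝ η (extChartAt X.I x x) w' v'

namespace HBundle

variable {X : Mfd.{u}} (E : HBundle X)

/-- The rank of the bundle. -/
def rank : ℕ := Fintype.card E.r

/-- The curvature matrix `dω + ω ∧ ω` in the frame around `p`. -/
def curvMatrix (p : X) (a b : E.r) (x : X) (v w : X.T x) : ℂ :=
  extD (E.conn p a b) x v w +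
    ∑ k, (E.conn p a k x v * E.conn p k b x w - E.conn p a k x w * E.conn p k b x v)

/-- The trace of the curvature, regarded as a real-valued 2-form by identifying `𝔲(1) = iℝ` with `ℝ`
(so the curvature form is `i (dω + ω ∧ ω)`).  For a line bundle this is the curvature 2-form. -/
def trCurv (x : X) (v w : X.T x) : ℂ :=
  Complex.I * ∑ a, E.curvMatrix x a a x v w

end HBundle

instance PreBundle.finiteDimensional {X : Mfd.{u}} (E : PreBundle X) (x : X) :
    FiniteDimensional ℂ (E.fib x) :=
  (E.frame x x).toBasis.finiteDimensional_of_finite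

namespace Fib

variable {X Y N M A : Mfd.{u}}


variable (π : SSub Y M)

/-- The threefold fibre product `Y ×_M Y ×_M Y`. -/
abbrev Triple : Mfd.{u} := Fib (π.comp (fst π π)) π

/-- The projection `(y₁, y₂, y₃) ↦ (y₁, y₂)`. -/
def p₁₂ : SMap (Triple π) (Fib π π) := pr₁ _ _

/-- The projection `(y₁, y₂, y₃) ↦ (y₂, y₃)`. -/
def p₂₃ : SMap (Triple π) (Fib π π) :=
  lift ((pr₂ π π).comp (pr₁ _ _)) (pr₂ _ _)
    (fun q => (sq π π (pr₁ _ _ q)).symm.trans (sq _ _ q))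

/-- The projection `(y₁, y₂, y₃) ↦ (y₁, y₃)`. -/
def p₁₃ : SMap (Triple π) (Fib π π) :=
  lift ((pr₁ π π).comp (pr₁ _ _)) (pr₂ _ _) (fun q => sq _ _ q)

end Fib

open Fib

/-! ### Bundle gerbes -/

/-- A bundle gerbe over `M`: a surjective submersion `π : Y → M`, a line bundle `L` over `Y ×_M Y`, a
2-form `C` on `Y`, and an isomorphism `μ : L₁₂ ⊗ L₂₃ → L₁₃` of line bundles over `Y ×_M Y ×_M Y`, such
that the curvature of `L` is `pr₂^* C - pr₁^* C` and `μ` is associative. -/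
structure Gerbe (M : Mfd.{u}) where
  Y : Mfd.{u}
  π : SSub Y M
  L : HBundle (Fib π π)
  rank_L : L.rank = 1
  C : TwoForm Y
  μ : ∀ (y₁ y₂ y₃ : Y) (h₁₂ : π y₁ = π y₂) (h₂₃ : π y₂ = π y₃),
    L.fib (pt y₁ y₂ h₁₂) ⊗[ℂ] L.fib (pt y₂ y₃ h₂₃) ≃ₗᵢ[ℂ] L.fib (pt y₁ y₃ (h₁₂.trans h₂₃))
  μ_hom : PreBundle.IsHom ((L.pull (p₁₂ π)).tensor (L.pull (p₂₃ π))).toPreBundle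
    (L.pull (p₁₃ π)).toPreBundle
    (fun q => (μ (pr₁ _ _ (pr₁ _ _ q)) (pr₂ _ _ (pr₁ _ _ q)) (pr₂ _ _ q)
      (sq _ _ (pr₁ _ _ q)) (sq _ _ (p₂₃ π q))).toLinearEquiv.toLinearMap)
  curv : ∀ q v w, L.trCurv q v w =
    ((C.pullAt (pr₂ π π) q v w - C.pullAt (pr₁ π π) q v w : ℝ) : ℂ)
  assoc : ∀ (y₁ y₂ y₃ y₄ : Y) (h₁₂ : π y₁ = π y₂) (h₂₃ : π y₂ = π y₃) (h₃₄ : π y₃ = π y₄)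
    (a : L.fib (pt y₁ y₂ h₁₂)) (b : L.fib (pt y₂ y₃ h₂₃)) (c : L.fib (pt y₃ y₄ h₃₄)),
    μ y₁ y₃ y₄ (h₁₂.trans h₂₃) h₃₄ (μ y₁ y₂ y₃ h₁₂ h₂₃ (a ⊗ₜ b) ⊗ₜ c) =
      μ y₁ y₂ y₄ h₁₂ (h₂₃.trans h₃₄) (a ⊗ₜ μ y₂ y₃ y₄ h₂₃ h₃₄ (b ⊗ₜ c))

namespace Gerbe

variable {M : Mfd.{u}} (G : Gerbe M)

/-- The fibre of `L` over `(y, y')`. -/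
abbrev Lf (y y' : G.Y) (h : G.π y = G.π y') : Type u := G.L.fib (Fib.pt y y' h)


theorem finrank_Lf (y y' : G.Y) (h : G.π y = G.π y') : Module.finrank ℂ (G.Lf y y' h) = 1 := by
  rw [Module.finrank_eq_card_basis (G.L.frame (Fib.pt y y' h) (Fib.pt y y' h)).toBasis]
  exact G.rank_L

/-- The linear form `a ↦ tr (μ (a ⊗ -))` on `L` over the diagonal; it is obtained from `μ` by
contracting with the dual line. -/
def tLin (y : G.Y) : G.Lf y y rfl →ₗ[ℂ] ℂ :=
  LinearMap.trace ℂ (G.Lf y y rfl) ∘ₗ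
    TensorProduct.curry (G.μ y y y rfl rfl).toLinearEquiv.toLinearMap

theorem tLin_smul (y : G.Y) (a b : G.Lf y y rfl) :
    G.tLin y a • b = G.μ y y y rfl rfl (a ⊗ₜ b) := by
  obtain ⟨c, hc⟩ := LinearMap.existsUnique_eq_smul_id_of_finrank_eq_one
    (G.finrank_Lf y y rfl)
    (TensorProduct.curry (G.μ y y y rfl rfl).toLinearEquiv.toLinearMap a)
  have h1 : G.tLin y a = c := by
    have : G.tLin y a = LinearMap.trace ℂ (G.Lf y y rfl)
      (TensorProduct.curry (G.μ y y y rfl rfl).toLinearEquiv.toLinearMap a) := rfl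
    rw [this, hc.1, map_smul, LinearMap.trace_id, G.finrank_Lf]
    simp
  have h2 := congrArg (fun f => f b) hc.1
  rw [h1]
  exact h2.symm

theorem norm_tLin (y : G.Y) (a : G.Lf y y rfl) : ‖G.tLin y a‖ = ‖a‖ := by
  have : Nontrivial (G.Lf y y rfl) :=
    Module.nontrivial_of_finrank_pos (R := ℂ) (by rw [G.finrank_Lf]; exact one_pos)
  obtain ⟨b, hb⟩ := exists_ne (0 : G.Lf y y rfl)
  have h := congrArg norm (G.tLin_smul y a b)
  rw [norm_smul, LinearIsometryEquiv.norm_map, TensorProduct.norm_tmul] at h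
  exact mul_right_cancel₀ (norm_ne_zero_iff.2 hb) h

/-- The canonical trivialization `t_μ` of `L` over the diagonal. -/
def t (y : G.Y) : G.Lf y y rfl ≃ₗᵢ[ℂ] ℂ where
  toLinearEquiv := LinearEquiv.ofInjectiveOfFinrankEq (G.tLin y)
    (LinearMap.ker_eq_bot.1 (LinearMap.ker_eq_bot'.2 fun a ha => by
      rw [← norm_eq_zero, ← G.norm_tLin y a, ha, norm_zero]))
    (by rw [G.finrank_Lf, Module.finrank_self])
  norm_map' a := G.norm_tLin y a

/-- The trivialization `t_μ` at a pair of points that are equal. -/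
def tEq (y y' : G.Y) (h : y = y') (hπ : G.π y = G.π y') : G.Lf y y' hπ ≃ₗᵢ[ℂ] ℂ :=
  (G.L.cast (show Fib.pt y y' hπ = Fib.pt y' y' rfl by subst h; rfl)).trans (G.t y')

/-- The identification of fibres of `L` along equalities of the two points. -/
def castL {y₁ y₂ y₁' y₂' : G.Y} (h₁ : y₁ = y₁') (h₂ : y₂ = y₂') (h : G.π y₁ = G.π y₂)
    (h' : G.π y₁' = G.π y₂') : G.Lf y₁ y₂ h ≃ₗᵢ[ℂ] G.Lf y₁' y₂' h' :=
  G.L.cast (show Fib.pt y₁ y₂ h = Fib.pt y₁' y₂' h' by subst h₁; subst h₂; rfl)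

end Gerbe

section OneMor

variable {M : Mfd.{u}}

section legs

variable {Y₁ Y₂ Z : Mfd.{u}} {π₁ : SSub Y₁ M} {π₂ : SSub Y₂ M} (ζ : SSub Z (Fib π₁ π₂))

/-- The projection `Z → Y₁`. -/
def leg₁ : SSub Z Y₁ := (fst π₁ π₂).comp ζ

/-- The projection `Z → Y₂`. -/
def leg₂ : SSub Z Y₂ := (snd π₁ π₂).comp ζ

/-- The projection `Z → M`. -/
def base : SSub Z M := π₁.comp (leg₁ ζ)

theorem base_eq (z : Z) : base ζ z = π₂ (leg₂ ζ z) := sq π₁ π₂ (ζ z)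

theorem base_eq_of_leg₂ {z z' : Z} (h : leg₂ ζ z = leg₂ ζ z') : base ζ z = base ζ z' :=
  (base_eq ζ z).trans ((congrArg π₂ h).trans (base_eq ζ z').symm)

theorem base_eq₂ {z z' : Z} (h : base ζ z = base ζ z') : π₂ (leg₂ ζ z) = π₂ (leg₂ ζ z') :=
  (base_eq ζ z).symm.trans (h.trans (base_eq ζ z'))

/-- The map `Z ×_M Z → Y₁ ×_M Y₁`. -/
def pair₁ : SMap (Fib (base ζ) (base ζ)) (Fib π₁ π₁) :=
  lift ((leg₁ ζ).toSMap.comp (pr₁ _ _)) ((leg₁ ζ).toSMap.comp (pr₂ _ _)) (fun q => sq _ _ q)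

/-- The map `Z ×_M Z → Y₂ ×_M Y₂`. -/
def pair₂ : SMap (Fib (base ζ) (base ζ)) (Fib π₂ π₂) :=
  lift ((leg₂ ζ).toSMap.comp (pr₁ _ _)) ((leg₂ ζ).toSMap.comp (pr₂ _ _))
    (fun q => base_eq₂ ζ (sq _ _ q))

end legs

/-- The data of a 1-morphism `G₁ → G₂`: a surjective submersion `ζ : Z → Y₁ ×_M Y₂`, a vector bundle `A`
over `Z` and isometries `α : L₁ ⊗ A_{z'} → A_z ⊗ L₂` for `(z, z')` in `Z ×_M Z`. -/
structure PreOneMor (G₁ G₂ : Gerbe M) where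
  Z : Mfd.{u}
  ζ : SSub Z (Fib G₁.π G₂.π)
  A : HBundle Z
  α : ∀ (z z' : Z) (h : base ζ z = base ζ z'),
    G₁.Lf (leg₁ ζ z) (leg₁ ζ z') h ⊗[ℂ] A.fib z' ≃ₗᵢ[ℂ]
      A.fib z ⊗[ℂ] G₂.Lf (leg₂ ζ z) (leg₂ ζ z') (base_eq₂ ζ h)

/-- A 1-morphism `G₁ → G₂`: `α` is an isomorphism of vector bundles over `Z ×_M Z` (smooth and
respecting the connections), the trace of the curvature of `A` divided by the rank is `C₂ - C₁`, and
`α` is compatible with `μ₁` and `μ₂` over `Z ×_M Z ×_M Z`. The rank is nonzero, as the curvature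
condition divides by it. -/
structure OneMor (G₁ G₂ : Gerbe M) extends PreOneMor G₁ G₂ where
  rank_pos : 0 < A.rank
  α_hom : PreBundle.IsHom
    ((G₁.L.pull (pair₁ ζ)).tensor (A.pull (pr₂ (base ζ) (base ζ)))).toPreBundle
    ((A.pull (pr₁ (base ζ) (base ζ))).tensor (G₂.L.pull (pair₂ ζ))).toPreBundle
    (fun q => (α (pr₁ _ _ q) (pr₂ _ _ q) (sq _ _ q)).toLinearEquiv.toLinearMap)
  curv : ∀ z v w, (1 / (A.rank : ℂ)) * A.trCurv z v w =
    ((G₂.C.pullAt (leg₂ ζ).toSMap z v w - G₁.C.pullAt (leg₁ ζ).toSMap z v w : ℝ) : ℂ)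
  compat : ∀ (z₁ z₂ z₃ : Z) (h₁₂ : base ζ z₁ = base ζ z₂) (h₂₃ : base ζ z₂ = base ζ z₃)
    (l : G₁.Lf (leg₁ ζ z₁) (leg₁ ζ z₂) h₁₂) (l' : G₁.Lf (leg₁ ζ z₂) (leg₁ ζ z₃) h₂₃)
    (a : A.fib z₃),
    α z₁ z₃ (h₁₂.trans h₂₃) (G₁.μ _ _ _ h₁₂ h₂₃ (l ⊗ₜ l') ⊗ₜ a) =
      LinearIsometryEquiv.lTensor (A.fib z₁) (G₂.μ _ _ _ (base_eq₂ ζ h₁₂) (base_eq₂ ζ h₂₃))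
        (TensorProduct.assocIsometry ℂ _ _ _
          (LinearIsometryEquiv.rTensor _ (α z₁ z₂ h₁₂)
            ((TensorProduct.assocIsometry ℂ _ _ _).symm (l ⊗ₜ α z₂ z₃ h₂₃ (l' ⊗ₜ a)))))

namespace PreOneMor

variable {G₁ G₂ G₃ G₄ : Gerbe M}

/-- The canonical isomorphism `d_A : A_z → A_{z'}` for `(z, z')` in `Z ×_P Z`, `P = Y₁ ×_M Y₂`: the
composite `A_z = A_z ⊗ L₂ → L₁ ⊗ A_{z'} = A_{z'}` of `t_{μ₂}⁻¹`, `α⁻¹` and `t_{μ₁}`. -/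
def d (A : PreOneMor G₁ G₂) (z z' : A.Z) (h : A.ζ z = A.ζ z') : A.A.fib z ≃ₗᵢ[ℂ] A.A.fib z' :=
  have h₁ : leg₁ A.ζ z = leg₁ A.ζ z' := congrArg (fst G₁.π G₂.π) h
  have h₂ : leg₂ A.ζ z = leg₂ A.ζ z' := congrArg (snd G₁.π G₂.π) h
  have hM : base A.ζ z = base A.ζ z' := congrArg G₁.π h₁
  (TensorProduct.ridIsometry ℂ (A.A.fib z)).symm.trans <|
    (LinearIsometryEquiv.lTensor (A.A.fib z) (G₂.tEq _ _ h₂ (base_eq₂ A.ζ hM)).symm).trans <|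
    (A.α z z' hM).symm.trans <|
    (LinearIsometryEquiv.rTensor (A.A.fib z') (G₁.tEq _ _ h₁ hM)).trans <|
    TensorProduct.lidIsometry ℂ (A.A.fib z')

/-- The identity 1-morphism: `Z = Y ×_M Y`, `A = L`, and
`α : L₁₃ ⊗ L₃₄ → L₁₄ → L₁₂ ⊗ L₂₄` given by `μ` and `μ⁻¹`. -/
def id (G : Gerbe M) : PreOneMor G G where
  Z := Fib G.π G.π
  ζ := SSub.id _
  A := G.L
  α z z' h :=
    (G.μ (pr₁ _ _ z) (pr₁ _ _ z') (pr₂ _ _ z') h (sq _ _ z')).trans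
      (G.μ (pr₁ _ _ z) (pr₂ _ _ z) (pr₂ _ _ z') (sq _ _ z)
        (base_eq₂ (SSub.id (Fib G.π G.π)) h)).symm

/-- The composition `A' ∘ A`: the fibre product `Z ×_{Y₂} Z'`, the bundle `A ⊗ A'` over it, and
`(id ⊗ α') ∘ (α ⊗ id)`. The axioms of a 1-morphism are inherited from `A` and `A'`. -/
def comp (A' : PreOneMor G₂ G₃) (A : PreOneMor G₁ G₂) : PreOneMor G₁ G₃ where
  Z := Fib (leg₂ A.ζ) (leg₁ A'.ζ)
  ζ := join A.ζ A'.ζ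
  A := (A.A.pull (pr₁ _ _)).tensor (A'.A.pull (pr₂ _ _))
  α p q h :=
    have hm : base A'.ζ (pr₂ _ _ p) = base A'.ζ (pr₂ _ _ q) :=
      (congrArg G₂.π (sq _ _ p)).symm.trans
        ((base_eq₂ A.ζ (z := pr₁ _ _ p) (z' := pr₁ _ _ q) h).trans (congrArg G₂.π (sq _ _ q)))
    (TensorProduct.assocIsometry ℂ _ _ _).symm.trans <|
    (LinearIsometryEquiv.rTensor _ (A.α (pr₁ _ _ p) (pr₁ _ _ q) h)).trans <|
    (TensorProduct.assocIsometry ℂ _ _ _).trans <|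
    (LinearIsometryEquiv.lTensor _
      ((LinearIsometryEquiv.rTensor _ (G₂.castL (sq _ _ p) (sq _ _ q) _ hm)).trans
        (A'.α (pr₂ _ _ p) (pr₂ _ _ q) hm))).trans <|
    (TensorProduct.assocIsometry ℂ _ _ _).symm

end PreOneMor

/-- The data of a triple `(W, ω, β)` representing a 2-morphism `A ⇒ B`: a surjective submersion
`sub : W → Z_A ×_P Z_B` and isometries `β w : A → B` of the fibres over the two components of `sub w`. -/
structure PreTwoMor {G₁ G₂ : Gerbe M} (A B : PreOneMor G₁ G₂) where
  W : Mfd.{u}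
  sub : SSub W (Fib A.ζ B.ζ)
  β : ∀ w : W, A.A.fib (pr₁ A.ζ B.ζ (sub w)) →ₗᵢ[ℂ] B.A.fib (pr₂ A.ζ B.ζ (sub w))

namespace PreTwoMor

variable {G₁ G₂ G₃ G₄ : Gerbe M}

/-- The projection `W → Z_A`. -/
def zA {A B : PreOneMor G₁ G₂} (b : PreTwoMor A B) : SSub b.W A.Z := (fst A.ζ B.ζ).comp b.sub

/-- The projection `W → Z_B`. -/
def zB {A B : PreOneMor G₁ G₂} (b : PreTwoMor A B) : SSub b.W B.Z := (snd A.ζ B.ζ).comp b.sub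

theorem leg₁_eq {A B : PreOneMor G₁ G₂} (b : PreTwoMor A B) (w : b.W) :
    leg₁ A.ζ (b.zA w) = leg₁ B.ζ (b.zB w) := congrArg (pr₁ G₁.π G₂.π) (sq _ _ (b.sub w))

theorem leg₂_eq {A B : PreOneMor G₁ G₂} (b : PreTwoMor A B) (w : b.W) :
    leg₂ A.ζ (b.zA w) = leg₂ B.ζ (b.zB w) := congrArg (pr₂ G₁.π G₂.π) (sq _ _ (b.sub w))

theorem base_eq {A B : PreOneMor G₁ G₂} (b : PreTwoMor A B) (w w' : b.W)
    (h : base A.ζ (b.zA w) = base A.ζ (b.zA w')) :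
    base B.ζ (b.zB w) = base B.ζ (b.zB w') :=
  (congrArg G₁.π (b.leg₁_eq w)).symm.trans (h.trans (congrArg G₁.π (b.leg₁_eq w')))

/-- The triple represents a 2-morphism: `β` is a morphism of vector bundles over `W`, and it is
compatible with the isomorphisms `α` of `A` and `B` over `W ×_M W`. -/
structure IsTwoMor {A B : PreOneMor G₁ G₂} (b : PreTwoMor A B) : Prop where
  hom : PreBundle.IsHom (A.A.pull b.zA.toSMap).toPreBundle (B.A.pull b.zB.toSMap).toPreBundle
    (fun w => (b.β w).toLinearMap)
  compat : ∀ (w w' : b.W) (h : base A.ζ (b.zA w) = base A.ζ (b.zA w'))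
    (l : G₁.Lf (leg₁ A.ζ (b.zA w)) (leg₁ A.ζ (b.zA w')) h) (a : A.A.fib (b.zA w')),
    B.α (b.zB w) (b.zB w') (b.base_eq w w' h)
      (G₁.castL (b.leg₁_eq w) (b.leg₁_eq w') h (b.base_eq w w' h) l ⊗ₜ b.β w' a) =
    TensorProduct.map (b.β w).toLinearMap
      (G₂.castL (b.leg₂_eq w) (b.leg₂_eq w') (base_eq₂ A.ζ h)
        (base_eq₂ B.ζ (b.base_eq w w' h))).toLinearEquiv.toLinearMap
      (A.α (b.zA w) (b.zA w') h (l ⊗ₜ a))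

/-- Two triples represent the same 2-morphism: there are surjective submersions from a manifold `X` to
`W` and `W'`, compatible with the projections to `Z_A ×_P Z_B`, such that the pullbacks of `β` and `β'`
to `X` coincide. -/
def Equiv {A B : PreOneMor G₁ G₂} (b b' : PreTwoMor A B) : Prop :=
  ∃ (X : Mfd.{u}) (s : SSub X b.W) (s' : SSub X b'.W) (h : ∀ x, b.sub (s x) = b'.sub (s' x)),
    ∀ (x : X) (a : A.A.fib (b.zA (s x))),
      B.A.cast (congrArg (pr₂ A.ζ B.ζ) (h x)) (b.β (s x) a) =
        b'.β (s' x) (A.A.cast (congrArg (pr₁ A.ζ B.ζ) (h x)) a)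

/-- The identity 2-morphism, represented by `(Z ×_P Z, id, d_A)`. -/
def id (A : PreOneMor G₁ G₂) : PreTwoMor A A where
  W := Fib A.ζ A.ζ
  sub := SSub.id _
  β q := (A.d (pr₁ _ _ q) (pr₂ _ _ q) (sq _ _ q)).toLinearIsometry

/-- The vertical composition `b' • b`, over `W ×_{Z_B} W'`. -/
def vcomp {A B C : PreOneMor G₁ G₂} (b' : PreTwoMor B C) (b : PreTwoMor A B) : PreTwoMor A C where
  W := Fib b.zB b'.zA
  sub := join b.sub b'.sub
  β q := (b'.β (pr₂ _ _ q)).comp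
    ((B.A.cast (sq _ _ q)).toLinearIsometry.comp (b.β (pr₁ _ _ q)))

/-- The horizontal composition `b₂ ∘ b₁`: over `Z̃ ×_P (W₁ ×_{Y₂} W₂) ×_P Z̃'`, the composite of
`d : Ã → Ã`, `β₁ ⊗ β₂` and `d : Ã' → Ã'`. -/
def hcomp {A₁ A₁' : PreOneMor G₁ G₂} {A₂ A₂' : PreOneMor G₂ G₃} (b₂ : PreTwoMor A₂ A₂')
    (b₁ : PreTwoMor A₁ A₁') : PreTwoMor (A₂.comp A₁) (A₂'.comp A₁') where
  W := Fib ((A₂.comp A₁).ζ.comp (fst (A₂.comp A₁).ζ (A₂'.comp A₁').ζ))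
    (join (A₁.ζ.comp b₁.zA) (A₂.ζ.comp b₂.zA))
  sub := fst _ _
  β w :=
    let z := pr₁ _ _ (pr₁ _ _ w)
    let z' := pr₂ _ _ (pr₁ _ _ w)
    let w₁ := pr₁ _ _ (pr₂ _ _ w)
    let w₂ := pr₂ _ _ (pr₂ _ _ w)
    have h : leg₂ A₁.ζ (b₁.zA w₁) = leg₁ A₂.ζ (b₂.zA w₂) := sq _ _ (pr₂ _ _ w)
    let u' : (A₂.comp A₁).Z := pt (b₁.zA w₁) (b₂.zA w₂) h
    let v : (A₂'.comp A₁').Z := pt (b₁.zB w₁) (b₂.zB w₂)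
      ((b₁.leg₂_eq w₁).symm.trans (h.trans (b₂.leg₁_eq w₂)))
    have hu : (A₂.comp A₁).ζ z = (A₂.comp A₁).ζ u' := sq _ _ w
    have huv : (A₂.comp A₁).ζ u' = (A₂'.comp A₁').ζ v :=
      Subtype.ext (Prod.ext (b₁.leg₁_eq w₁) (b₂.leg₂_eq w₂))
    have hv : (A₂'.comp A₁').ζ v = (A₂'.comp A₁').ζ z' :=
      huv.symm.trans (hu.symm.trans (sq _ _ (pr₁ _ _ w)))
    ((A₂'.comp A₁').d v z' hv).toLinearIsometry.comp
      ((TensorProduct.mapIsometry (b₁.β w₁) (b₂.β w₂)).comp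
        ((A₂.comp A₁).d z u' hu).toLinearIsometry)

/-- The 2-isomorphism `λ_A : A ∘ id ⇒ A`: over `Z̃ ×_P Z`, the map
`L₁ ⊗ A_z → A_{z'} ⊗ L₂ = A_{z'}` given by `α` and `t_{μ₂}`. -/
def lam (A : PreOneMor G₁ G₂) : PreTwoMor (A.comp (PreOneMor.id G₁)) A where
  W := Fib (A.comp (PreOneMor.id G₁)).ζ A.ζ
  sub := SSub.id _
  β q :=
    let p := pr₁ _ _ q
    let z : A.Z := pr₂ _ _ p
    let z' : A.Z := pr₂ _ _ q
    have h : (A.comp (PreOneMor.id G₁)).ζ p = A.ζ z' := sq _ _ q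
    have h₁ : pr₁ _ _ (pr₁ _ _ p) = leg₁ A.ζ z' := congrArg (pr₁ _ _) h
    have h₁' : pr₂ _ _ (pr₁ _ _ p) = leg₁ A.ζ z := sq _ _ p
    have h₂ : leg₂ A.ζ z' = leg₂ A.ζ z := (congrArg (pr₂ _ _) h).symm
    have hM : base A.ζ z' = base A.ζ z :=
      base_eq_of_leg₂ A.ζ h₂
    ((LinearIsometryEquiv.rTensor (A.A.fib z)
        (G₁.castL h₁ h₁' (sq _ _ (pr₁ _ _ p)) hM)).trans <|
      (A.α z' z hM).trans <|
      (LinearIsometryEquiv.lTensor (A.A.fib z') (G₂.tEq _ _ h₂ (base_eq₂ A.ζ hM))).trans <|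
      TensorProduct.ridIsometry ℂ (A.A.fib z')).toLinearIsometry

/-- The 2-isomorphism `ρ_A : id ∘ A ⇒ A`: over `Z̃ ×_P Z`, the map
`A_z ⊗ L₂ → L₁ ⊗ A_{z'} = A_{z'}` given by `α⁻¹` and `t_{μ₁}`. -/
def rho (A : PreOneMor G₁ G₂) : PreTwoMor ((PreOneMor.id G₂).comp A) A where
  W := Fib ((PreOneMor.id G₂).comp A).ζ A.ζ
  sub := SSub.id _
  β q :=
    let p := pr₁ _ _ q
    let z : A.Z := pr₁ _ _ p
    let z' : A.Z := pr₂ _ _ q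
    have h : ((PreOneMor.id G₂).comp A).ζ p = A.ζ z' := sq _ _ q
    have h₀ := congrArg (pr₁ G₁.π G₂.π) h
    have h₁ : leg₁ A.ζ z = leg₁ A.ζ z' := h₀
    have h₂ : pr₁ _ _ (pr₂ _ _ p) = leg₂ A.ζ z := (sq _ _ p).symm
    have h₂' : pr₂ _ _ (pr₂ _ _ p) = leg₂ A.ζ z' := congrArg (pr₂ _ _) h
    have hM : base A.ζ z = base A.ζ z' := congrArg G₁.π h₁
    ((LinearIsometryEquiv.lTensor (A.A.fib z)
        (G₂.castL h₂ h₂' (sq _ _ (pr₂ _ _ p)) (base_eq₂ A.ζ hM))).trans <|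
      (A.α z z' hM).symm.trans <|
      (LinearIsometryEquiv.rTensor (A.A.fib z') (G₁.tEq _ _ h₁ hM)).trans <|
      TensorProduct.lidIsometry ℂ (A.A.fib z')).toLinearIsometry

/-- The point `((z, z'), z'')` corresponding to `(z, (z', z''))`. -/
def assocPt (A'' : PreOneMor G₃ G₄) (A' : PreOneMor G₂ G₃) (A : PreOneMor G₁ G₂)
    (p : ((A''.comp A').comp A).Z) : (A''.comp (A'.comp A)).Z :=
  pt (X := (A'.comp A).Z) (Y := A''.Z)
    (pt (X := A.Z) (Y := A'.Z) (pr₁ _ _ p) (pr₁ _ _ (pr₂ _ _ p)) (sq _ _ p))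
    (pr₂ _ _ (pr₂ _ _ p)) (sq _ _ (pr₂ _ _ p))

/-- The canonical identification `A ⊗ (A' ⊗ A'') = (A ⊗ A') ⊗ A''` of the fibres at corresponding
points. -/
def assocFib (A'' : PreOneMor G₃ G₄) (A' : PreOneMor G₂ G₃) (A : PreOneMor G₁ G₂)
    (p : ((A''.comp A').comp A).Z) :
    ((A''.comp A').comp A).A.fib p ≃ₗᵢ[ℂ] (A''.comp (A'.comp A)).A.fib (assocPt A'' A' A p) :=
  (TensorProduct.assocIsometry ℂ (A.A.fib (pr₁ _ _ p)) (A'.A.fib (pr₁ _ _ (pr₂ _ _ p)))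
    (A''.A.fib (pr₂ _ _ (pr₂ _ _ p)))).symm

/-- The canonical identification `(A'' ∘ A') ∘ A ⇒ A'' ∘ (A' ∘ A)`. Both sides have the same data up to
re-bracketing of fibre products and tensor products; under this re-bracketing it is the identity
2-morphism. -/
def assoc (A'' : PreOneMor G₃ G₄) (A' : PreOneMor G₂ G₃) (A : PreOneMor G₁ G₂) :
    PreTwoMor ((A''.comp A').comp A) (A''.comp (A'.comp A)) where
  W := Fib ((A''.comp A').comp A).ζ (A''.comp (A'.comp A)).ζ
  sub := SSub.id _
  β q := ((assocFib A'' A' A (pr₁ _ _ q)).trans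
    ((A''.comp (A'.comp A)).d (assocPt A'' A' A (pr₁ _ _ q)) (pr₂ _ _ q)
      (sq _ _ q))).toLinearIsometry

/-- The triple represents a 2-isomorphism, that is, a 2-morphism with a two-sided inverse under vertical
composition. -/
def IsIso {A B : PreOneMor G₁ G₂} (b : PreTwoMor A B) : Prop :=
  b.IsTwoMor ∧ ∃ c : PreTwoMor B A, c.IsTwoMor ∧
    Equiv (c.vcomp b) (PreTwoMor.id A) ∧ Equiv (b.vcomp c) (PreTwoMor.id B)

end PreTwoMor

/-- A 1-morphism `A : G₁ → G₂` is invertible if there are a 1-morphism `B : G₂ → G₁` and 2-isomorphisms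
`il : B ∘ A ⇒ id` and `ir : id ⇒ A ∘ B` such that
`λ_A • (id_A ∘ il) • (ir ∘ id_A) = ρ_A` as 2-morphisms `id ∘ A ⇒ A` (where `(A ∘ B) ∘ A` and
`A ∘ (B ∘ A)` are identified). The 2-morphisms are given by representing triples. -/
def OneMor.IsInvertible {G₁ G₂ : Gerbe M} (A : OneMor G₁ G₂) : Prop :=
  ∃ (B : OneMor G₂ G₁)
    (il : PreTwoMor (B.toPreOneMor.comp A.toPreOneMor) (PreOneMor.id G₁))
    (ir : PreTwoMor (PreOneMor.id G₂) (A.toPreOneMor.comp B.toPreOneMor)),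
    il.IsIso ∧ ir.IsIso ∧
    PreTwoMor.Equiv
      ((PreTwoMor.lam A.toPreOneMor).vcomp
        (((PreTwoMor.id A.toPreOneMor).hcomp il).vcomp
          ((PreTwoMor.assoc A.toPreOneMor B.toPreOneMor A.toPreOneMor).vcomp
            (ir.hcomp (PreTwoMor.id A.toPreOneMor)))))
      (PreTwoMor.rho A.toPreOneMor)

/-- All fibres of the bundle have dimension `n`. -/
def HBundle.HasRank {X : Mfd.{u}} (E : HBundle X) (n : ℕ) : Prop :=
  ∀ x, Module.finrank ℂ (E.fib x) = n

end OneMor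

end

end BundleGerbes

/-! If `A` is invertible, the 2-morphism `il` is fibrewise an injection of a fibre of `A ⊗ B` into a
fibre of the line bundle `L₁`. So the product of the two positive ranks is at most one
(`IsInvertible.hasRank`).

Conversely, when `A` has rank one, the inverse is the dual of `A`, with `Z → Y₁ ×_M Y₂` flipped. To
avoid diagram chases in tensor products, unit vectors are chosen by pure choice, without continuity:
in the fibres of `L₁` and `L₂` so that `μ` multiplies them, and in the fibres of `A` so that `α`
respects them (the structures `FlatSec`, with the two lemmas `exists_flatSec`). Every structural map
(`t_μ`, `d`, `λ`, `ρ`, the rebracketing, both compositions) then carries chosen vectors to chosen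
vectors. A linear map out of a line is determined by its value on a generator, so any two triples
that match the same chosen vectors are equivalent (`Flat.equiv`). In particular the zigzag identity
costs nothing.

What remains is smoothness and compatibility with connections. A frame of a line bundle is `u • e`
with `e` the chosen section and `u` a possibly wild function. Together with the connection form `ω`
this gives a pair `(u, ω)`, taken modulo pairs with `u` smooth at the point and `du = ω u` there.
The resulting class lies in an abelian group, is additive under tensor products, changes sign under
duals and commutes with pullback. A map matching the chosen sections is a bundle morphism iff the
classes agree at every point (`HBundle.isHom_iff`). Hence the regularity of `μ` and of `α` becomes a
pair of linear identities between classes (`Gerbe.FlatSec.cls_mul`, `OneMor.cls_map`), and the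
regularity of the dual `α`, of `il` and of `ir` follows from these by group arithmetic. -/

namespace BundleGerbes

noncomputable section

section

/-! ### Unit vectors spanning a complex line -/

section Line

variable {V W : Type*} [NormedAddCommGroup V] [InnerProductSpace ℂ V]
  [NormedAddCommGroup W] [InnerProductSpace ℂ W]

/-- `v` is a unit vector spanning `V`; in particular `V` is a line. -/
structure IsUnitGen (v : V) : Prop where
  norm_eq : ‖v‖ = 1
  span : ∀ w : V, ∃ c : ℂ, w = c • v

namespace IsUnitGen

theorem ne_zero {v : V} (hv : IsUnitGen v) : v ≠ 0 := by
  intro h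
  have := hv.norm_eq
  simp [h] at this

theorem inner_self {v : V} (hv : IsUnitGen v) : inner ℂ v v = (1 : ℂ) := by
  rw [inner_self_eq_norm_sq_to_K, hv.norm_eq]; simp

theorem finrank_eq {v : V} (hv : IsUnitGen v) : Module.finrank ℂ V = 1 :=
  (finrank_eq_one_iff_of_nonzero' v hv.ne_zero).2 fun w => (hv.span w).imp fun _ h => h.symm

theorem of_norm_eq {v : V} (h : Module.finrank ℂ V = 1) (hv : ‖v‖ = 1) : IsUnitGen v where
  norm_eq := hv
  span w := by
    have h0 : v ≠ 0 := by rintro rfl; simp at hv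
    exact ((finrank_eq_one_iff_of_nonzero' v h0).1 h w).imp fun _ h => h.symm

theorem exists_of_finrank (h : Module.finrank ℂ V = 1) : ∃ v : V, IsUnitGen v := by
  have : Nontrivial V := Module.nontrivial_of_finrank_pos (R := ℂ) (by rw [h]; exact one_pos)
  obtain ⟨v, hv⟩ := exists_norm_eq V (zero_le_one : (0 : ℝ) ≤ 1)
  exact ⟨v, of_norm_eq h hv⟩

theorem eq_smul {v : V} (hv : IsUnitGen v) (w : V) : w = inner ℂ v w • v := by
  obtain ⟨c, rfl⟩ := hv.span w
  rw [inner_smul_right, hv.inner_self, mul_one]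

theorem map_equiv {v : V} (hv : IsUnitGen v) (f : V ≃ₗᵢ[ℂ] W) : IsUnitGen (f v) where
  norm_eq := (f.norm_map v).trans hv.norm_eq
  span w := by
    obtain ⟨c, hc⟩ := hv.span (f.symm w)
    exact ⟨c, by rw [← map_smul, ← hc, f.apply_symm_apply]⟩

theorem tmul {v : V} {w : W} (hv : IsUnitGen v) (hw : IsUnitGen w) : IsUnitGen (v ⊗ₜ[ℂ] w) where
  norm_eq := by rw [TensorProduct.norm_tmul, hv.norm_eq, hw.norm_eq, one_mul]
  span t := by
    induction t with
    | zero => exact ⟨0, by simp⟩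
    | tmul a b =>
      obtain ⟨c, rfl⟩ := hv.span a
      obtain ⟨d, rfl⟩ := hw.span b
      exact ⟨c * d, by rw [TensorProduct.smul_tmul_smul]⟩
    | add a b ha hb =>
      obtain ⟨c, rfl⟩ := ha
      obtain ⟨d, rfl⟩ := hb
      exact ⟨c + d, by rw [add_smul]⟩

/-- Every element of `V ⊗ W` is a pure tensor if `W` is a line. -/
theorem exists_tmul_right {w : W} (hw : IsUnitGen w) (t : V ⊗[ℂ] W) : ∃ a : V, t = a ⊗ₜ w := by
  induction t with
  | zero => exact ⟨0, by simp⟩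
  | tmul a b =>
    obtain ⟨c, rfl⟩ := hw.span b
    exact ⟨c • a, by rw [TensorProduct.smul_tmul]⟩
  | add a b ha hb =>
    obtain ⟨c, rfl⟩ := ha
    obtain ⟨d, rfl⟩ := hb
    exact ⟨c + d, by rw [TensorProduct.add_tmul]⟩

/-- A linear map out of a line is determined by its value on a generator. -/
theorem hom_ext {U : Type*} [AddCommGroup U] [Module ℂ U] {v : V} (hv : IsUnitGen v)
    {f g : V →ₗ[ℂ] U} (h : f v = g v) : f = g := by
  ext w
  obtain ⟨c, rfl⟩ := hv.span w
  rw [map_smul, map_smul, h]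

/-- The orthonormal basis given by a unit vector spanning a line. -/
def basis {v : V} (hv : IsUnitGen v) (r : Type*) [Fintype r] [Nonempty r] [Subsingleton r]
    (c : r → ℂ) (hc : ∀ a, ‖c a‖ = 1) : OrthonormalBasis r ℂ V :=
  -- General phases `c`, rather than the constant 1, are needed for the frames of the dual bundle,
  -- where the phase varies with the base point.
  OrthonormalBasis.mk (v := fun a => c a • v)
    ⟨fun a => by rw [norm_smul, hc, hv.norm_eq, one_mul],
      fun a b h => (h (Subsingleton.elim a b)).elim⟩ (by
    rintro w -
    obtain ⟨d, rfl⟩ := hv.span w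
    let a : r := Classical.arbitrary r
    have h0 : c a ≠ 0 := norm_ne_zero_iff.1 (by rw [hc]; exact one_ne_zero)
    have : d • v = (d * (c a)⁻¹) • c a • v := by
      rw [smul_smul, mul_assoc, inv_mul_cancel₀ h0, mul_one]
    rw [this]
    exact Submodule.smul_mem _ _ (Submodule.subset_span ⟨a, rfl⟩))

theorem basis_apply {v : V} (hv : IsUnitGen v) (r : Type*) [Fintype r] [Nonempty r]
    [Subsingleton r] (c : r → ℂ) (hc : ∀ a, ‖c a‖ = 1) (a : r) :
    hv.basis r c hc a = c a • v :=
   congrFun (OrthonormalBasis.coe_mk _ _) a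

/-- The isometry between two lines that matches given generators. -/
def equiv {v : V} {w : W} (hv : IsUnitGen v) (hw : IsUnitGen w) : V ≃ₗᵢ[ℂ] W :=
  (hv.basis Unit 1 (by simp)).equiv (hw.basis Unit 1 (by simp)) (Equiv.refl _)

@[simp] theorem equiv_apply {v : V} {w : W} (hv : IsUnitGen v) (hw : IsUnitGen w) :
    hv.equiv hw v = w := by
  have h := OrthonormalBasis.equiv_apply_basis (hv.basis Unit 1 (by simp))
    (hw.basis Unit 1 (by simp)) (Equiv.refl _) ()
  rw [basis_apply, Equiv.refl_apply, basis_apply, Pi.one_apply, one_smul, one_smul] at h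
  exact h

end IsUnitGen

end Line

/-! ### Unit sections of line bundles -/

namespace PreBundle

variable {X Y : Mfd.{u}}

/-- A choice of unit vectors in the fibres of a bundle of rank one, without any continuity. -/
structure USec (E : PreBundle X) where
  e : ∀ x, E.fib x
  gen : ∀ x, IsUnitGen (e x)

/-! ### Logarithmic classes: functions and forms modulo parallel functions -/

/-- A function with values in `ℂˣ`, not assumed continuous, and the value of a 1-form at a point. -/
abbrev LogDatum (X : Mfd.{u}) (x₀ : X) : Type u := (X → Additive ℂˣ) × (X.T x₀ →L[ℝ] ℂ)

/-- The underlying complex-valued function of a logarithmic datum. -/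
def unitVal (u : X → Additive ℂˣ) (x : X) : ℂ := ((u x).toMul : ℂˣ)

theorem unitVal_add (u v : X → Additive ℂˣ) : unitVal (u + v) = unitVal u * unitVal v :=
  funext fun x => by simp [unitVal]

theorem unitVal_ne_zero (u : X → Additive ℂˣ) (x : X) : unitVal u x ≠ 0 := Units.ne_zero _

theorem unitVal_neg (u : X → Additive ℂˣ) : unitVal (-u) = fun x => (unitVal u x)⁻¹ :=
  funext fun x => by simp [unitVal]

theorem dFun_mul {f g : X → ℂ} {x : X} (hf : MDifferentiableAt X.I 𝓘(ℝ, ℂ) f x)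
    (hg : MDifferentiableAt X.I 𝓘(ℝ, ℂ) g x) (v : X.T x) :
    dFun (f * g) x v = f x * dFun g x v + g x * dFun f x v := by
  have := (hf.hasMFDerivAt.mul hg.hasMFDerivAt).mfderiv
  exact congrArg (fun L => L v) this

/-- The subgroup of those pairs `(u, ω)` for which `u` is smooth at `x₀` and `du = ω u` there. -/
def par (x₀ : X) : AddSubgroup (LogDatum X x₀) where
  carrier := {d | ContMDiffAt X.I 𝓘(ℝ, ℂ) ∞ (unitVal d.1) x₀ ∧
    ∀ v, dFun (unitVal d.1) x₀ v = d.2 v * unitVal d.1 x₀}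
  zero_mem' := by
    have h : unitVal (0 : X → Additive ℂˣ) = fun _ => (1 : ℂ) := by funext x; simp [unitVal]
    refine ⟨?_, fun v => ?_⟩
    · rw [Prod.fst_zero, h]; exact contMDiffAt_const
    · rw [Prod.fst_zero, h]
      simp [dFun, mfderiv_const]
      rfl
  -- Logarithmic derivatives add when functions are multiplied, by the Leibniz rule.
  add_mem' := by
    rintro a b ⟨ha, ha'⟩ ⟨hb, hb'⟩
    refine ⟨?_, fun v => ?_⟩
    · rw [Prod.fst_add, unitVal_add]
      have hm : ContDiff ℝ ∞ (fun c : ℂ × ℂ => c.1 * c.2) := contDiff_fst.mul contDiff_snd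
      exact hm.contMDiff.contMDiffAt.comp x₀ (ha.prodMk_space hb)
    · rw [Prod.fst_add, unitVal_add,
        dFun_mul (ha.mdifferentiableAt (by simp)) (hb.mdifferentiableAt (by simp)), ha', hb']
      simp only [Pi.mul_apply, Prod.snd_add, _root_.add_apply]
      ring
  neg_mem' := by
    rintro a ⟨ha, ha'⟩
    have hs : ContMDiffAt X.I 𝓘(ℝ, ℂ) ∞ (unitVal (-a.1)) x₀ := by
      rw [unitVal_neg]
      have hm : ContDiffAt ℝ ∞ (fun c : ℂ => c⁻¹) (unitVal a.1 x₀) :=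
        contDiffAt_inv ℝ (unitVal_ne_zero _ _)
      exact hm.contMDiffAt.comp x₀ ha
    refine ⟨hs, fun v => ?_⟩
    -- Differentiating `u * u⁻¹ = 1` yields the logarithmic derivative of the inverse from the
    -- product rule alone.
    have h1 : unitVal a.1 * unitVal (-a.1) = fun _ => (1 : ℂ) := by
      rw [unitVal_neg]; funext x
      exact mul_inv_cancel₀ (unitVal_ne_zero _ _)
    have h2 := dFun_mul (ha.mdifferentiableAt (by simp)) (hs.mdifferentiableAt (by simp)) v
    have h3 : dFun (unitVal a.1 * unitVal (-a.1)) x₀ v = 0 := by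
      rw [h1]; simp [dFun, mfderiv_const]; rfl
    rw [h3, ha'] at h2
    have h0 := unitVal_ne_zero a.1 x₀
    have h4 := congrFun h1 x₀
    refine mul_left_cancel₀ h0 ?_
    simp only [Prod.snd_neg, Prod.fst_neg, neg_apply, Pi.mul_apply] at h4 ⊢
    linear_combination -h2

/-- Logarithmic data up to parallel functions. -/
abbrev LogClass (X : Mfd.{u}) (x₀ : X) : Type u := LogDatum X x₀ ⧸ par x₀

instance (x₀ : X) : AddCommGroup (LogClass X x₀) := QuotientAddGroup.Quotient.addCommGroup _

/-- The pullback of logarithmic classes. -/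
def pullClass (f : SMap X Y) (x₀ : X) : LogClass Y (f x₀) →+ LogClass X x₀ :=
  QuotientAddGroup.map _ _
    { toFun := fun d => (fun x => d.1 (f x), d.2.comp (mfderiv X.I Y.I f x₀))
      map_zero' := by ext <;> rfl
      map_add' := fun a b => by ext <;> rfl } (by
    rintro d ⟨h1, h2⟩
    refine ⟨h1.comp x₀ (f.smooth x₀), fun v => ?_⟩
    have hc : dFun (fun x => unitVal d.1 (f x)) x₀ =
        (dFun (unitVal d.1) (f x₀)).comp (mfderiv X.I Y.I f x₀) :=
      mfderiv_comp x₀ (h1.mdifferentiableAt (by simp)) ((f.smooth x₀).mdifferentiableAt (by simp))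
    exact (congrArg (fun L => L v) hc).trans (h2 _))

/-! ### The class of a line bundle with a unit section -/

namespace USec

variable {E F : PreBundle X}

theorem card_eq (s : E.USec) (x : X) : Fintype.card E.r = 1 := by
  rw [← (s.gen x).finrank_eq, Module.finrank_eq_card_basis (E.frame x x).toBasis]

theorem subsingleton (s : E.USec) (x : X) : Subsingleton E.r :=
  Fintype.card_le_one_iff_subsingleton.1 (s.card_eq x).le

theorem nonempty (s : E.USec) (x : X) : Nonempty E.r :=
  Fintype.card_pos_iff.1 (by rw [s.card_eq x]; exact one_pos)

theorem norm_inner_frame (s : E.USec) (p x : X) (b : E.r) :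
    ‖inner ℂ (s.e x) (E.frame p x b)‖ = 1 := by
  have h := congrArg norm ((s.gen x).eq_smul (E.frame p x b))
  rwa [norm_smul, (s.gen x).norm_eq, mul_one, (E.frame p x).norm_eq_one, eq_comm] at h

theorem inner_frame_ne_zero (s : E.USec) (p x : X) (b : E.r) :
    inner ℂ (s.e x) (E.frame p x b) ≠ (0 : ℂ) :=
  norm_ne_zero_iff.1 (by rw [s.norm_inner_frame]; exact one_ne_zero)

/-- The coordinate is a phase, and for phases conjugation is inversion. -/
theorem inner_frame_swap (s : E.USec) (p x : X) (b : E.r) :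
    inner ℂ (E.frame p x b) (s.e x) = (inner ℂ (s.e x) (E.frame p x b) : ℂ)⁻¹ := by
  rw [← inner_conj_symm, Complex.inv_def, Complex.normSq_eq_norm_sq, s.norm_inner_frame]
  simp

/-- The logarithmic datum of a line bundle: the coordinate of a local frame with respect to the unit
section, and the connection form. -/
def datum (s : E.USec) (p : X) (b : E.r) (x₀ : X) : LogDatum X x₀ :=
  (fun x => Additive.ofMul (Units.mk0 _ (s.inner_frame_ne_zero p x b)), E.conn p b b x₀)

/-- A frame vector `u • s.e` goes to `u • t.e`, and the coordinate of `t.e` in the frame `u' • t.e`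
is `u'⁻¹`. The single matrix entry of `φ` is thus the quotient `u / u'`, which in additive notation
is a difference of data. -/
theorem coef_eq (s : E.USec) (t : F.USec) {φ : ∀ x, E.fib x →ₗ[ℂ] F.fib x}
    (hφ : ∀ x, φ x (s.e x) = t.e x) (p q : X) (a : F.r) (b : E.r) (x₀ : X) :
    coef E F φ p q a b = unitVal (s.datum p b x₀ - t.datum q a x₀).1 := by
  funext x
  have h : φ x (E.frame p x b) = (inner ℂ (s.e x) (E.frame p x b) : ℂ) • t.e x := by
    conv_lhs => rw [(s.gen x).eq_smul (E.frame p x b)]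
    rw [map_smul, hφ]
  rw [coef, h, inner_smul_right, inner_frame_swap]
  simp [unitVal, datum, div_eq_mul_inv]

/-- For a one-by-one matrix `m`, the equation `dm + ω_F m = m ω_E` reads `dm = (ω_E - ω_F) m`, which
is the condition defining `par`. Being a bundle morphism thereby becomes membership in a subgroup.
-/
theorem isHom_iff_datum (s : E.USec) (t : F.USec) {φ : ∀ x, E.fib x →ₗ[ℂ] F.fib x}
    (hφ : ∀ x, φ x (s.e x) = t.e x) (hE : ∀ p, IsOpen (E.dom p)) (hF : ∀ p, IsOpen (F.dom p)) :
    IsHom E F φ ↔ ∀ p q a b x₀, x₀ ∈ E.dom p → x₀ ∈ F.dom q →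
      s.datum p b x₀ - t.datum q a x₀ ∈ par x₀ := by
  have key : ∀ p q a b x₀, (∀ v : X.T x₀, dFun (coef E F φ p q a b) x₀ v +
      ∑ k, F.conn q a k x₀ v * coef E F φ p q k b x₀ =
      ∑ k, coef E F φ p q a k x₀ * E.conn p k b x₀ v) ↔
      ∀ v, dFun (unitVal (s.datum p b x₀ - t.datum q a x₀).1) x₀ v =
        (s.datum p b x₀ - t.datum q a x₀).2 v * unitVal (s.datum p b x₀ - t.datum q a x₀).1 x₀ := by
    intro p q a b x₀
    have := s.subsingleton x₀
    have := t.subsingleton x₀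
    refine forall_congr' fun v => ?_
    rw [Fintype.sum_subsingleton _ a, Fintype.sum_subsingleton _ b, coef_eq s t hφ p q a b x₀]
    simp only [datum, Prod.snd_sub, sub_apply]
    constructor <;> intro h <;> linear_combination h
  constructor
  · intro h p q a b x₀ hp hq
    refine ⟨?_, (key p q a b x₀).1 (h.parallel p q a b x₀ ⟨hp, hq⟩)⟩
    rw [← coef_eq s t hφ p q a b x₀]
    exact (h.smooth p q a b).contMDiffAt (((hE p).inter (hF q)).mem_nhds ⟨hp, hq⟩)
  · intro h
    refine ⟨fun p q a b x hx => ?_, fun p q a b x hx => (key p q a b x).2 (h p q a b x hx.1 hx.2).2⟩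
    rw [coef_eq s t hφ p q a b x]
    exact (h p q a b x hx.1 hx.2).1.contMDiffWithinAt

/-- The class of a line bundle with unit section at a point. -/
def cls (s : E.USec) (x₀ : X) : LogClass X x₀ :=
  QuotientAddGroup.mk (s.datum x₀ (Classical.choice (s.nonempty x₀)) x₀)

theorem cls_eq (s : E.USec) (x₀ : X) (b : E.r) :
    s.cls x₀ = QuotientAddGroup.mk (s.datum x₀ b x₀) := by
  have := s.subsingleton x₀
  rw [cls, Subsingleton.elim (Classical.choice (s.nonempty x₀)) b]

/-- The pulled back unit section. -/
@[reducible] def pull {E : PreBundle Y} (s : E.USec) (f : SMap X Y) : (E.pull f).USec where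
  e x := s.e (f x)
  gen x := s.gen (f x)

/-- The tensor product of unit sections. -/
@[reducible] def tensor (s : E.USec) (t : F.USec) : (E.tensor F).USec where
  e x := s.e x ⊗ₜ t.e x
  gen x := (s.gen x).tmul (t.gen x)

/-- Holds definitionally because `cls` uses the frame centred at the point itself, and the frame of
a pullback around `x₀` is by construction the frame around `f x₀`. -/
theorem cls_pull {E : PreBundle Y} (s : E.USec) (f : SMap X Y) (x₀ : X) :
    (s.pull f).cls x₀ = pullClass f x₀ (s.cls (f x₀)) := by
  obtain ⟨b⟩ := s.nonempty (f x₀)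
  rw [s.cls_eq (f x₀) b, cls_eq _ x₀ b]
  rfl

/-- Pulling back along a composite and pulling back twice give the same frames; the connection forms
agree by the chain rule. -/
theorem cls_pull_comp {Z : Mfd.{u}} {E : PreBundle Z} (s : E.USec) (f : SMap Y Z) (k : SMap X Y)
    (x₀ : X) : (s.pull (f.comp k)).cls x₀ = pullClass k x₀ ((s.pull f).cls (k x₀)) := by
  rw [← cls_pull]
  obtain ⟨b⟩ := s.nonempty (f (k x₀))
  rw [cls_eq _ x₀ b, cls_eq _ x₀ b]
  congr 1
  refine Prod.ext rfl ?_
  have hc : mfderiv X.I Z.I (fun x => f (k x)) x₀ =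
      (mfderiv Y.I Z.I f (k x₀)).comp (mfderiv X.I Y.I k x₀) :=
    mfderiv_comp x₀ ((f.smooth _).mdifferentiableAt (by simp))
      ((k.smooth x₀).mdifferentiableAt (by simp))
  exact congrArg (fun L => (E.conn (f (k x₀)) b b (f (k x₀))).comp L) hc

/-- On a tensor product of lines, frame coordinates multiply and connection forms add. -/
theorem cls_tensor (s : E.USec) (t : F.USec) (x₀ : X) :
    (s.tensor t).cls x₀ = s.cls x₀ + t.cls x₀ := by
  obtain ⟨a⟩ := s.nonempty x₀
  obtain ⟨b⟩ := t.nonempty x₀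
  rw [cls_eq _ x₀ (a, b), s.cls_eq x₀ a, t.cls_eq x₀ b, ← QuotientAddGroup.mk_add]
  congr 1
  refine Prod.ext (funext fun x => ?_) ?_
  · refine Additive.toMul.injective (Units.ext ?_)
    simp [datum, OrthonormalBasis.tensorProduct_apply']
  · simp [datum]

end USec

end PreBundle

open PreBundle

/-- All analytic content is concentrated here. By `compat` the identity of each bundle is a
morphism, so changing the frame does not change the class, and comparing the frames centred at each
point suffices. -/
theorem HBundle.isHom_iff {X : Mfd.{u}} {E F : HBundle X} (s : E.USec) (t : F.USec)
    {φ : ∀ x, E.fib x →ₗ[ℂ] F.fib x} (hφ : ∀ x, φ x (s.e x) = t.e x) :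
    IsHom E.toPreBundle F.toPreBundle φ ↔ ∀ x₀, s.cls x₀ = t.cls x₀ := by
  have hE := (s.isHom_iff_datum s (φ := fun _ => LinearMap.id) (fun _ => rfl) E.isOpen
    E.isOpen).1 E.compat
  have hF := (t.isHom_iff_datum t (φ := fun _ => LinearMap.id) (fun _ => rfl) F.isOpen
    F.isOpen).1 F.compat
  rw [s.isHom_iff_datum t hφ E.isOpen F.isOpen]
  constructor
  · intro h x₀
    obtain ⟨b⟩ := s.nonempty x₀
    obtain ⟨a⟩ := t.nonempty x₀
    rw [s.cls_eq x₀ b, t.cls_eq x₀ a, eq_comm, QuotientAddGroup.eq]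
    have := h x₀ x₀ a b x₀ (E.mem x₀) (F.mem x₀)
    rwa [sub_eq_neg_add] at this
  · intro h p q a b x₀ hp hq
    have h1 := h x₀
    rw [s.cls_eq x₀ b, t.cls_eq x₀ a, eq_comm, QuotientAddGroup.eq] at h1
    -- The difference telescopes: from the frame around `p` to the one around `x₀` in `E`, across to
    -- `F` at `x₀`, then to the frame around `q` in `F`.
    have h2 := hE p x₀ b b x₀ hp (E.mem x₀)
    have h3 := hF x₀ q a a x₀ (F.mem x₀) hq
    have h4 := add_mem (add_mem h2 h1) h3
    convert h4 using 1
    abel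

end

/-! ### Sections multiplied by `μ` and respected by `α` -/

section

open PreBundle Fib

theorem _root_.LinearIsometry.comp_comp_apply_eq {V₁ V₂ V₃ V₄ : Type*}
    [NormedAddCommGroup V₁] [InnerProductSpace ℂ V₁] [NormedAddCommGroup V₂]
    [InnerProductSpace ℂ V₂] [NormedAddCommGroup V₃] [InnerProductSpace ℂ V₃]
    [NormedAddCommGroup V₄] [InnerProductSpace ℂ V₄] {f : V₁ →ₗᵢ[ℂ] V₂} {g : V₂ →ₗᵢ[ℂ] V₃}
    {h : V₃ →ₗᵢ[ℂ] V₄} {a : V₁} {b : V₂} {c : V₃} {d : V₄} (hf : f a = b) (hg : g b = c)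
    (hh : h c = d) : (h.comp (g.comp f)) a = d := by
  rw [← hh, ← hg, ← hf]; rfl

@[simp] theorem PreBundle.USec.cast_e {X : Mfd.{u}} {E : PreBundle X} (s : E.USec) {x y : X}
    (h : x = y) : E.cast h (s.e x) = s.e y := by
  subst h; rfl

variable {M : Mfd.{u}} {G₁ G₂ G₃ G₄ : Gerbe M}

/-- Unit vectors in the fibres of the line bundle of a gerbe that are multiplied by `μ`. -/
structure Gerbe.FlatSec (G : Gerbe M) extends G.L.toPreBundle.USec where
  mul : ∀ (y₁ y₂ y₃ : G.Y) (h₁₂ : G.π y₁ = G.π y₂) (h₂₃ : G.π y₂ = G.π y₃),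
    G.μ y₁ y₂ y₃ h₁₂ h₂₃ (e (pt y₁ y₂ h₁₂) ⊗ₜ e (pt y₂ y₃ h₂₃)) = e (pt y₁ y₃ (h₁₂.trans h₂₃))

namespace Gerbe.FlatSec

variable {G : Gerbe M} (s : G.FlatSec)

theorem mul_symm (y₁ y₂ y₃ : G.Y) (h₁₂ : G.π y₁ = G.π y₂) (h₂₃ : G.π y₂ = G.π y₃) :
    (G.μ y₁ y₂ y₃ h₁₂ h₂₃).symm (s.e (pt y₁ y₃ (h₁₂.trans h₂₃))) =
      s.e (pt y₁ y₂ h₁₂) ⊗ₜ s.e (pt y₂ y₃ h₂₃) := by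
  rw [← s.mul y₁ y₂ y₃ h₁₂ h₂₃, LinearIsometryEquiv.symm_apply_apply]

/-- Over the diagonal the chosen vector is idempotent under `μ`, so the scalar by which it
multiplies itself is 1. -/
theorem t_apply (y : G.Y) : G.t y (s.e (pt y y rfl)) = 1 := by
  have h := G.tLin_smul y (s.e (pt y y rfl)) (s.e (pt y y rfl))
  rw [s.mul y y y rfl rfl] at h
  exact smul_left_injective ℂ (s.gen (pt y y rfl)).ne_zero (h.trans (one_smul ℂ _).symm)

theorem tEq_apply (y y' : G.Y) (h : y = y') (hπ : G.π y = G.π y') :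
    G.tEq y y' h hπ (s.e (pt y y' hπ)) = 1 := by
  subst h
  exact s.t_apply y

theorem tEq_symm_apply (y y' : G.Y) (h : y = y') (hπ : G.π y = G.π y') :
    (G.tEq y y' h hπ).symm 1 = s.e (pt y y' hπ) := by
  rw [← s.tEq_apply y y' h hπ, LinearIsometryEquiv.symm_apply_apply]

theorem castL_apply {y₁ y₂ y₁' y₂' : G.Y} (h₁ : y₁ = y₁') (h₂ : y₂ = y₂') (h : G.π y₁ = G.π y₂)
    (h' : G.π y₁' = G.π y₂') :
    G.castL h₁ h₂ h h' (s.e (pt y₁ y₂ h)) = s.e (pt y₁' y₂' h') := by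
  subst h₁; subst h₂; rfl

end Gerbe.FlatSec

/-- Unit vectors in the fibres of the bundle of a 1-morphism that are respected by `α`. -/
structure PreOneMor.FlatSec (A : PreOneMor G₁ G₂) (s₁ : G₁.FlatSec) (s₂ : G₂.FlatSec) extends
    A.A.toPreBundle.USec where
  map : ∀ (z z' : A.Z) (h : base A.ζ z = base A.ζ z'),
    A.α z z' h (s₁.e (pt (leg₁ A.ζ z) (leg₁ A.ζ z') h) ⊗ₜ e z') =
      e z ⊗ₜ s₂.e (pt (leg₂ A.ζ z) (leg₂ A.ζ z') (base_eq₂ A.ζ h))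

namespace PreOneMor.FlatSec

variable {s₁ : G₁.FlatSec} {s₂ : G₂.FlatSec} {s₃ : G₃.FlatSec}

theorem map_symm {A : PreOneMor G₁ G₂} (s : A.FlatSec s₁ s₂) (z z' : A.Z)
    (h : base A.ζ z = base A.ζ z') :
    (A.α z z' h).symm (s.e z ⊗ₜ s₂.e (pt (leg₂ A.ζ z) (leg₂ A.ζ z') (base_eq₂ A.ζ h))) =
      s₁.e (pt (leg₁ A.ζ z) (leg₁ A.ζ z') h) ⊗ₜ s.e z' := by
  rw [← s.map z z' h, LinearIsometryEquiv.symm_apply_apply]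

/-- The factors of `d` act by `e z ↦ e z ⊗ s₂ ↦ s₁ ⊗ e z' ↦ e z'`, since both trivializations match
the chosen vectors with 1. -/
theorem d_apply {A : PreOneMor G₁ G₂} (s : A.FlatSec s₁ s₂) (z z' : A.Z) (h : A.ζ z = A.ζ z') :
    A.d z z' h (s.e z) = s.e z' := by
  have h₁ : leg₁ A.ζ z = leg₁ A.ζ z' := congrArg (fst G₁.π G₂.π) h
  have h₂ : leg₂ A.ζ z = leg₂ A.ζ z' := congrArg (snd G₁.π G₂.π) h
  have hM : base A.ζ z = base A.ζ z' := congrArg G₁.π h₁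
  have e1 := s₂.tEq_symm_apply _ _ h₂ (base_eq₂ A.ζ hM)
  have e2 := s.map_symm z z' hM
  have e3 := s₁.tEq_apply _ _ h₁ hM
  refine (congrArg (fun l => TensorProduct.lidIsometry ℂ (A.A.fib z')
    (LinearIsometryEquiv.rTensor (A.A.fib z') (G₁.tEq _ _ h₁ hM)
      ((A.α z z' hM).symm (s.e z ⊗ₜ l)))) e1).trans ?_
  refine (congrArg (fun t => TensorProduct.lidIsometry ℂ (A.A.fib z')
    (LinearIsometryEquiv.rTensor (A.A.fib z') (G₁.tEq _ _ h₁ hM) t)) e2).trans ?_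
  exact (congrArg (fun c : ℂ => c • s.e z') e3).trans (one_smul ℂ _)

/-- The flat section of the identity 1-morphism. -/
@[reducible] def id {G : Gerbe M} (s : G.FlatSec) : (PreOneMor.id G).FlatSec s s where
  e := s.e
  gen := s.gen
  map z z' h := by
    -- Both factorizations of the chosen vector over the outer pair of points are by chosen vectors.
    refine (congrArg _ (s.mul (pr₁ _ _ z) (pr₁ _ _ z') (pr₂ _ _ z') h (sq _ _ z'))).trans ?_
    exact s.mul_symm (pr₁ _ _ z) (pr₂ _ _ z) (pr₂ _ _ z') (sq _ _ z) _

/-- The flat section of a composition. -/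
@[reducible] def comp {A' : PreOneMor G₂ G₃} {A : PreOneMor G₁ G₂} (s' : A'.FlatSec s₂ s₃)
    (s : A.FlatSec s₁ s₂) : (A'.comp A).FlatSec s₁ s₃ where
  toUSec := (s.toUSec.pull (pr₁ _ _)).tensor (s'.toUSec.pull (pr₂ _ _))
  map p q h := by
    have hm : base A'.ζ (pr₂ _ _ p) = base A'.ζ (pr₂ _ _ q) :=
      (congrArg G₂.π (sq _ _ p)).symm.trans
        ((base_eq₂ A.ζ (z := pr₁ _ _ p) (z' := pr₁ _ _ q) h).trans (congrArg G₂.π (sq _ _ q)))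
    -- `α` turns `s₁` into `s₂` while passing the section of `A`; after recentring on the legs of
    -- `A'`, `α'` turns `s₂` into `s₃` while passing the section of `A'`.
    have e1 := s.map (pr₁ _ _ p) (pr₁ _ _ q) h
    have e2 := s₂.castL_apply (sq _ _ p) (sq _ _ q)
      (base_eq₂ A.ζ (z := pr₁ _ _ p) (z' := pr₁ _ _ q) h) hm
    have e3 := s'.map (pr₂ _ _ p) (pr₂ _ _ q) hm
    have f1 := congrArg (fun t => t ⊗ₜ[ℂ] s'.e (pr₂ _ _ q)) e1
    have f2 := congrArg (fun t => A'.α (pr₂ _ _ p) (pr₂ _ _ q) hm (t ⊗ₜ[ℂ] s'.e (pr₂ _ _ q))) e2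
    have f3 := congrArg (fun t => s.e (pr₁ _ _ p) ⊗ₜ[ℂ] t) (f2.trans e3)
    have f4 := congrArg (fun t => (TensorProduct.assocIsometry ℂ _ _ _).symm
      (LinearIsometryEquiv.lTensor _
        ((LinearIsometryEquiv.rTensor _ (G₂.castL (sq _ _ p) (sq _ _ q)
          (base_eq₂ A.ζ (z := pr₁ _ _ p) (z' := pr₁ _ _ q) h) hm)).trans
          (A'.α (pr₂ _ _ p) (pr₂ _ _ q) hm)) (TensorProduct.assocIsometry ℂ _ _ _ t))) f1
    exact f4.trans (congrArg (fun t => (TensorProduct.assocIsometry ℂ _ _ _).symm t) f3)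

end PreOneMor.FlatSec

/-! ### 2-morphisms that match chosen sections -/

namespace PreTwoMor

variable {s₁ : G₁.FlatSec} {s₂ : G₂.FlatSec} {s₃ : G₃.FlatSec} {s₄ : G₄.FlatSec}

/-- The triple matches given unit sections. -/
def Flat {A B : PreOneMor G₁ G₂} (b : PreTwoMor A B) (s : A.A.toPreBundle.USec)
    (t : B.A.toPreBundle.USec) : Prop :=
  ∀ w, b.β w (s.e (b.zA w)) = t.e (b.zB w)

/-- On the common refinement `W ×_{Z_A ×_P Z_B} W'` both maps send the same generator of a line to
the same vector, so they coincide. Every equation of 2-morphisms needed later follows from this,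
with no smoothness involved. -/
theorem Flat.equiv {A B : PreOneMor G₁ G₂} {b b' : PreTwoMor A B} {s : A.A.toPreBundle.USec}
    {t : B.A.toPreBundle.USec} (h : b.Flat s t) (h' : b'.Flat s t) : b.Equiv b' := by
  refine ⟨Fib b.sub b'.sub, fst _ _, snd _ _, fun x => sq _ _ x, fun x a => ?_⟩
  have hx : b.sub (fst b.sub b'.sub x) = b'.sub (snd b.sub b'.sub x) := sq _ _ x
  let x₁ := fst b.sub b'.sub x
  let x₂ := snd b.sub b'.sub x
  have hA := congrArg (pr₁ A.ζ B.ζ) hx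
  have hB := congrArg (pr₂ A.ζ B.ζ) hx
  have key : ((B.A.cast hB).toLinearIsometry.comp (b.β x₁)).toLinearMap =
      ((b'.β x₂).comp (A.A.cast hA).toLinearIsometry).toLinearMap := by
    refine (s.gen (b.zA x₁)).hom_ext ?_
    refine (congrArg (B.A.cast hB) (h x₁)).trans ((t.cast_e hB).trans ?_)
    exact ((congrArg (b'.β x₂) (s.cast_e hA)).trans (h' x₂)).symm
  exact LinearMap.congr_fun key a

theorem Flat.id {A : PreOneMor G₁ G₂} (s : A.FlatSec s₁ s₂) :
    (PreTwoMor.id A).Flat s.toUSec s.toUSec :=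
  fun q => s.d_apply (pr₁ _ _ q) (pr₂ _ _ q) (sq _ _ q)

theorem Flat.vcomp {A B C : PreOneMor G₁ G₂} {b' : PreTwoMor B C} {b : PreTwoMor A B}
    {s : A.A.toPreBundle.USec} {t : B.A.toPreBundle.USec} {r : C.A.toPreBundle.USec}
    (h' : b'.Flat t r) (h : b.Flat s t) : (b'.vcomp b).Flat s r := by
  intro q
  refine Eq.trans (congrArg (fun a => b'.β (pr₂ _ _ q) (B.A.cast (sq _ _ q) a))
    (h (pr₁ _ _ q))) ?_
  refine Eq.trans (congrArg (b'.β (pr₂ _ _ q)) (t.cast_e (sq _ _ q))) ?_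
  exact h' (pr₂ _ _ q)

-- The outer factors `d` match the sections of the composites by `d_apply`; the middle factor is a
-- tensor product of two matching maps.
set_option maxRecDepth 10000 in
theorem Flat.hcomp {A₁ A₁' : PreOneMor G₁ G₂} {A₂ A₂' : PreOneMor G₂ G₃} {b₂ : PreTwoMor A₂ A₂'}
    {b₁ : PreTwoMor A₁ A₁'} {t₁ : A₁.FlatSec s₁ s₂} {t₁' : A₁'.FlatSec s₁ s₂}
    {t₂ : A₂.FlatSec s₂ s₃} {t₂' : A₂'.FlatSec s₂ s₃} (h₂ : b₂.Flat t₂.toUSec t₂'.toUSec)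
    (h₁ : b₁.Flat t₁.toUSec t₁'.toUSec) :
    (b₂.hcomp b₁).Flat (t₂.comp t₁).toUSec (t₂'.comp t₁').toUSec := by
  intro w
  let w₁ := pr₁ _ _ (pr₂ _ _ w)
  let w₂ := pr₂ _ _ (pr₂ _ _ w)
  have h : leg₂ A₁.ζ (b₁.zA w₁) = leg₁ A₂.ζ (b₂.zA w₂) := sq _ _ (pr₂ _ _ w)
  let u' : (A₂.comp A₁).Z := pt (b₁.zA w₁) (b₂.zA w₂) h
  let v : (A₂'.comp A₁').Z := pt (b₁.zB w₁) (b₂.zB w₂)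
    ((b₁.leg₂_eq w₁).symm.trans (h.trans (b₂.leg₁_eq w₂)))
  have hu : (A₂.comp A₁).ζ (pr₁ _ _ (pr₁ _ _ w)) = (A₂.comp A₁).ζ u' := sq _ _ w
  have huv : (A₂.comp A₁).ζ u' = (A₂'.comp A₁').ζ v :=
    Subtype.ext (Prod.ext (b₁.leg₁_eq w₁) (b₂.leg₂_eq w₂))
  have hv : (A₂'.comp A₁').ζ v = (A₂'.comp A₁').ζ (pr₂ _ _ (pr₁ _ _ w)) :=
    huv.symm.trans (hu.symm.trans (sq _ _ (pr₁ _ _ w)))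
  have e1 := (t₂.comp t₁).d_apply _ u' hu
  have e2 : TensorProduct.mapIsometry (b₁.β w₁) (b₂.β w₂) ((t₂.comp t₁).e u') =
      (t₂'.comp t₁').e v := congrArg₂ (fun a b => a ⊗ₜ[ℂ] b) (h₁ w₁) (h₂ w₂)
  have e3 := (t₂'.comp t₁').d_apply v _ hv
  exact LinearIsometry.comp_comp_apply_eq (f := ((A₂.comp A₁).d _ u' hu).toLinearIsometry)
    (g := TensorProduct.mapIsometry (b₁.β w₁) (b₂.β w₂))
    (h := ((A₂'.comp A₁').d v _ hv).toLinearIsometry) e1 e2 e3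

/-- The path of the generator is `s₁ ⊗ e ↦ e ⊗ s₂ ↦ e`, through `α` and then `t_{μ₂}`; `Flat.rho`
traverses `α` backwards and ends with `t_{μ₁}`. -/
theorem Flat.lam {A : PreOneMor G₁ G₂} (s : A.FlatSec s₁ s₂) :
    (PreTwoMor.lam A).Flat (s.comp (.id s₁)).toUSec s.toUSec := by
  intro q
  let p := pr₁ _ _ q
  let z : A.Z := pr₂ _ _ p
  let z' : A.Z := pr₂ _ _ q
  have h : (A.comp (PreOneMor.id G₁)).ζ p = A.ζ z' := sq _ _ q
  have h₁ : pr₁ _ _ (pr₁ _ _ p) = leg₁ A.ζ z' := congrArg (pr₁ _ _) h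
  have h₁' : pr₂ _ _ (pr₁ _ _ p) = leg₁ A.ζ z := sq _ _ p
  have h₂ : leg₂ A.ζ z' = leg₂ A.ζ z := (congrArg (pr₂ _ _) h).symm
  have hM : base A.ζ z' = base A.ζ z := base_eq_of_leg₂ A.ζ h₂
  have e1 := s₁.castL_apply h₁ h₁' (sq _ _ (pr₁ _ _ p)) hM
  have e2 := s.map z' z hM
  have e3 := s₂.tEq_apply _ _ h₂ (base_eq₂ A.ζ hM)
  refine (congrArg (fun l => TensorProduct.ridIsometry ℂ (A.A.fib z')
    (LinearIsometryEquiv.lTensor (A.A.fib z') (G₂.tEq _ _ h₂ (base_eq₂ A.ζ hM))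
      (A.α z' z hM (l ⊗ₜ s.e z)))) e1).trans ?_
  refine (congrArg (fun t => TensorProduct.ridIsometry ℂ (A.A.fib z')
    (LinearIsometryEquiv.lTensor (A.A.fib z') (G₂.tEq _ _ h₂ (base_eq₂ A.ζ hM)) t)) e2).trans ?_
  refine (congrArg (fun c : ℂ => c • s.e z') e3).trans ?_
  exact one_smul ℂ _

theorem Flat.rho {A : PreOneMor G₁ G₂} (s : A.FlatSec s₁ s₂) :
    (PreTwoMor.rho A).Flat ((PreOneMor.FlatSec.id s₂).comp s).toUSec s.toUSec := by
  intro q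
  let p := pr₁ _ _ q
  let z : A.Z := pr₁ _ _ p
  let z' : A.Z := pr₂ _ _ q
  have h : ((PreOneMor.id G₂).comp A).ζ p = A.ζ z' := sq _ _ q
  have h₀ := congrArg (pr₁ G₁.π G₂.π) h
  have h₁ : leg₁ A.ζ z = leg₁ A.ζ z' := h₀
  have h₂ : pr₁ _ _ (pr₂ _ _ p) = leg₂ A.ζ z := (sq _ _ p).symm
  have h₂' : pr₂ _ _ (pr₂ _ _ p) = leg₂ A.ζ z' := congrArg (pr₂ _ _) h
  have hM : base A.ζ z = base A.ζ z' := congrArg G₁.π h₁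
  have e1 := s₂.castL_apply h₂ h₂' (sq _ _ (pr₂ _ _ p)) (base_eq₂ A.ζ hM)
  have e2 := s.map_symm z z' hM
  have e3 := s₁.tEq_apply _ _ h₁ hM
  refine (congrArg (fun l => TensorProduct.lidIsometry ℂ (A.A.fib z')
    (LinearIsometryEquiv.rTensor (A.A.fib z') (G₁.tEq _ _ h₁ hM)
      ((A.α z z' hM).symm (s.e z ⊗ₜ l)))) e1).trans ?_
  refine (congrArg (fun t => TensorProduct.lidIsometry ℂ (A.A.fib z')
    (LinearIsometryEquiv.rTensor (A.A.fib z') (G₁.tEq _ _ h₁ hM) t)) e2).trans ?_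
  refine (congrArg (fun c : ℂ => c • s.e z') e3).trans ?_
  exact one_smul ℂ _

/-- Rebracketing carries `e ⊗ (e' ⊗ e'')` to `(e ⊗ e') ⊗ e''`, so only the factor `d` needs an
argument. -/
theorem Flat.assoc {A'' : PreOneMor G₃ G₄} {A' : PreOneMor G₂ G₃} {A : PreOneMor G₁ G₂}
    (s'' : A''.FlatSec s₃ s₄) (s' : A'.FlatSec s₂ s₃) (s : A.FlatSec s₁ s₂) :
    (PreTwoMor.assoc A'' A' A).Flat ((s''.comp s').comp s).toUSec (s''.comp (s'.comp s)).toUSec :=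
  fun q => (s''.comp (s'.comp s)).d_apply (assocPt A'' A' A (pr₁ _ _ q)) (pr₂ _ _ q) (sq _ _ q)

/-- The 2-morphism that matches given unit sections. -/
def ofSec {A B : PreOneMor G₁ G₂} (s : A.A.toPreBundle.USec) (t : B.A.toPreBundle.USec) :
    PreTwoMor A B where
  W := Fib A.ζ B.ζ
  sub := SSub.id _
  β _ := ((s.gen _).equiv (t.gen _)).toLinearIsometry

theorem Flat.ofSec {A B : PreOneMor G₁ G₂} (s : A.A.toPreBundle.USec)
    (t : B.A.toPreBundle.USec) : (PreTwoMor.ofSec s t).Flat s t :=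
  fun w => IsUnitGen.equiv_apply (s.gen (pr₁ A.ζ B.ζ w)) (t.gen (pr₂ A.ζ B.ζ w))

/-- The equality of classes is needed only for smoothness and parallelism. Compatibility with `α` is
automatic: both sides are linear maps out of the line `L₁ ⊗ A` and agree on its generator. -/
theorem isTwoMor_ofSec {A B : PreOneMor G₁ G₂} (s : A.FlatSec s₁ s₂) (t : B.FlatSec s₁ s₂)
    (h : ∀ w, (s.toUSec.pull (pr₁ A.ζ B.ζ)).cls w = (t.toUSec.pull (pr₂ A.ζ B.ζ)).cls w) :
    (ofSec s.toUSec t.toUSec).IsTwoMor where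
  hom := (HBundle.isHom_iff (E := A.A.pull (pr₁ A.ζ B.ζ)) (F := B.A.pull (pr₂ A.ζ B.ζ))
    (s.toUSec.pull _) (t.toUSec.pull _)
    (φ := fun w => ((ofSec s.toUSec t.toUSec).β w).toLinearMap) (Flat.ofSec s.toUSec t.toUSec)).2 h
  compat w w' hM l a := by
    let b := ofSec s.toUSec t.toUSec
    have e1 := s₁.castL_apply (b.leg₁_eq w) (b.leg₁_eq w') hM (b.base_eq w w' hM)
    have e2 := Flat.ofSec s.toUSec t.toUSec w'
    have e3 := t.map (b.zB w) (b.zB w') (b.base_eq w w' hM)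
    have e4 := s.map (b.zA w) (b.zA w') hM
    have e5 := Flat.ofSec s.toUSec t.toUSec w
    have e6 := s₂.castL_apply (b.leg₂_eq w) (b.leg₂_eq w') (base_eq₂ A.ζ hM)
      (base_eq₂ B.ζ (b.base_eq w w' hM))
    have key : (B.α (b.zB w) (b.zB w') (b.base_eq w w' hM)).toLinearEquiv.toLinearMap ∘ₗ
        TensorProduct.map (G₁.castL (b.leg₁_eq w) (b.leg₁_eq w') hM
          (b.base_eq w w' hM)).toLinearEquiv.toLinearMap (b.β w').toLinearMap =
        TensorProduct.map (b.β w).toLinearMap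
          (G₂.castL (b.leg₂_eq w) (b.leg₂_eq w') (base_eq₂ A.ζ hM)
            (base_eq₂ B.ζ (b.base_eq w w' hM))).toLinearEquiv.toLinearMap ∘ₗ
          (A.α (b.zA w) (b.zA w') hM).toLinearEquiv.toLinearMap := by
      refine ((s₁.gen _).tmul (s.gen _)).hom_ext ?_
      refine (congrArg (B.α (b.zB w) (b.zB w') (b.base_eq w w' hM))
        (congrArg₂ (fun x y => x ⊗ₜ[ℂ] y) e1 e2)).trans (e3.trans ?_)
      refine Eq.trans ?_ (congrArg _ e4).symm
      exact (congrArg₂ (fun (x : B.A.fib (b.zB w)) y => x ⊗ₜ[ℂ] y) e5 e6).symm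
    exact LinearMap.congr_fun key (l ⊗ₜ a)

/-- The map exchanging the factors of a fibre product. -/
def _root_.BundleGerbes.Fib.swap {X Y N : Mfd.{u}} (f : SSub X N) (g : SSub Y N) :
    SMap (Fib f g) (Fib g f) :=
  lift (pr₂ f g) (pr₁ f g) fun q => (sq f g q).symm

/-- The inverse is the matching triple in the other direction: both composites match the same
sections as the identities, so `Flat.equiv` applies. -/
theorem isIso_ofSec {A B : PreOneMor G₁ G₂} (s : A.FlatSec s₁ s₂) (t : B.FlatSec s₁ s₂)
    (h : ∀ w, (s.toUSec.pull (pr₁ A.ζ B.ζ)).cls w = (t.toUSec.pull (pr₂ A.ζ B.ζ)).cls w) :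
    (ofSec s.toUSec t.toUSec).IsIso := by
  refine ⟨isTwoMor_ofSec s t h, ofSec t.toUSec s.toUSec, isTwoMor_ofSec t s fun w => ?_,
    (Flat.vcomp (Flat.ofSec _ _) (Flat.ofSec _ _)).equiv (Flat.id s),
    (Flat.vcomp (Flat.ofSec _ _) (Flat.ofSec _ _)).equiv (Flat.id t)⟩
  -- The class identity for the inverse is the given one pulled back along the exchange of factors.
  have e1 := t.toUSec.cls_pull_comp (pr₂ A.ζ B.ζ) (Fib.swap B.ζ A.ζ) w
  have e2 := s.toUSec.cls_pull_comp (pr₁ A.ζ B.ζ) (Fib.swap B.ζ A.ζ) w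
  rw [← h] at e1
  exact e1.trans e2.symm

end PreTwoMor

end

section

open PreBundle Fib

theorem IsUnitGen.tmul_right_cancel {V W : Type*} [NormedAddCommGroup V] [InnerProductSpace ℂ V]
    [NormedAddCommGroup W] [InnerProductSpace ℂ W] {w : W} (hw : IsUnitGen w) {a b : V}
    (h : a ⊗ₜ[ℂ] w = b ⊗ₜ w) : a = b := by
  rw [← sub_eq_zero, ← TensorProduct.sub_tmul, ← norm_eq_zero, TensorProduct.norm_tmul,
    hw.norm_eq, mul_one, norm_eq_zero] at h
  exact sub_eq_zero.1 h

theorem SMap.ext {X Y : Mfd.{u}} {f g : SMap X Y} (h : ∀ x, f x = g x) : f = g := by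
  cases f; cases g
  congr 1
  exact funext h

variable {M : Mfd.{u}} {G₁ G₂ : Gerbe M}

/-! ### Existence of flat sections -/

/-- Division in lines: `μ (u ⊗ -)` can be solved up to a scalar, and the solution is a unit vector
because `μ` is isometric. -/
theorem Gerbe.exists_unitGen (G : Gerbe M) (a b c : G.Y) (hab : G.π a = G.π b)
    (hbc : G.π b = G.π c) {u : G.Lf a b hab} (hu : IsUnitGen u) {w : G.Lf a c (hab.trans hbc)}
    (hw : IsUnitGen w) : ∃ v : G.Lf b c hbc, IsUnitGen v ∧ G.μ a b c hab hbc (u ⊗ₜ v) = w := by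
  obtain ⟨x, hx⟩ := IsUnitGen.exists_of_finrank (G.finrank_Lf b c hbc)
  obtain ⟨d, hd⟩ := ((hu.tmul hx).map_equiv (G.μ a b c hab hbc)).span w
  have h : G.μ a b c hab hbc (u ⊗ₜ (d • x)) = w := by
    rw [TensorProduct.tmul_smul, map_smul, ← hd]
  refine ⟨d • x, .of_norm_eq (G.finrank_Lf b c hbc) ?_, h⟩
  have := congrArg norm h
  rwa [LinearIsometryEquiv.norm_map, TensorProduct.norm_tmul, hu.norm_eq, hw.norm_eq,
    one_mul] at this

/-- On a single fibre of `π` the cocycle is a coboundary. With a base point `y₀` and unit vectors `k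
y` in `L` over `(y₀, y)`, the vector `e (y, y')` is the quotient of `k y'` by `k y`. As no
continuity is asked, this is done fibre by fibre. -/
theorem Gerbe.exists_flatSec (G : Gerbe M) : Nonempty G.FlatSec := by
  choose y₀ hy₀ using G.π.surj
  choose k hk using fun (m : M) (y : G.Y) (h : G.π (y₀ m) = G.π y) =>
    IsUnitGen.exists_of_finrank (G.finrank_Lf (y₀ m) y h)
  choose e he he' using fun (q : Fib G.π G.π) =>
    G.exists_unitGen (y₀ (G.π (pr₁ _ _ q))) (pr₁ _ _ q) (pr₂ _ _ q) (hy₀ _) (sq _ _ q)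
      (hk _ _ (hy₀ _)) (hk _ _ ((hy₀ _).trans (sq _ _ q)))
  have spec : ∀ (m : M) (y y' : G.Y) (hm : G.π (y₀ m) = G.π y) (h : G.π y = G.π y'),
      G.μ (y₀ m) y y' hm h (k m y hm ⊗ₜ e (pt y y' h)) = k m y' (hm.trans h) := by
    intro m y y' hm h
    obtain rfl : m = G.π y := (hy₀ m).symm.trans hm
    exact he' (pt y y' h)
  refine ⟨⟨⟨e, he⟩, fun y₁ y₂ y₃ h₁₂ h₂₃ => ?_⟩⟩
  have hm : G.π (y₀ (G.π y₁)) = G.π y₁ := hy₀ _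
  -- Both `e₁₂ e₂₃` and `e₁₃` give `k y₃` when multiplied on the left by `k y₁`, which is then
  -- cancelled.
  have h1 := G.assoc _ y₁ y₂ y₃ hm h₁₂ h₂₃ (k _ y₁ hm) (e (pt y₁ y₂ h₁₂)) (e (pt y₂ y₃ h₂₃))
  rw [spec _ y₁ y₂ hm h₁₂, spec _ y₂ y₃ (hm.trans h₁₂) h₂₃, ← spec _ y₁ y₃ hm (h₁₂.trans h₂₃)] at h1
  have h2 := (G.μ _ _ _ _ _).injective h1
  have : ∀ a b : G.Lf y₁ y₃ (h₁₂.trans h₂₃), k _ y₁ hm ⊗ₜ[ℂ] a = k _ y₁ hm ⊗ₜ b → a = b := by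
    intro a b h
    rw [← sub_eq_zero, ← TensorProduct.tmul_sub, ← norm_eq_zero, TensorProduct.norm_tmul,
      (hk _ y₁ hm).norm_eq, one_mul, norm_eq_zero] at h
    exact sub_eq_zero.1 h
  exact (this _ _ h2).symm

/-- A unit vector is fixed at one point `z₀` over each point of `M` and transported by `α` to the
other points over it; the compatibility of `α` with `μ₁` and `μ₂` makes the transport consistent. -/
theorem OneMor.exists_flatSec (A : OneMor G₁ G₂) (hA : A.A.HasRank 1) (s₁ : G₁.FlatSec)
    (s₂ : G₂.FlatSec) : Nonempty (A.toPreOneMor.FlatSec s₁ s₂) := by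
  choose z₀ hz₀ using (base A.ζ).surj
  choose a₀ ha₀ using fun m => IsUnitGen.exists_of_finrank (hA (z₀ m))
  have ex : ∀ z, ∃ a : A.A.fib z, IsUnitGen a ∧ A.α z (z₀ (base A.ζ z)) (hz₀ _).symm
      (s₁.e (pt (leg₁ A.ζ z) (leg₁ A.ζ (z₀ (base A.ζ z))) (hz₀ _).symm) ⊗ₜ a₀ (base A.ζ z)) =
      a ⊗ₜ s₂.e (pt (leg₂ A.ζ z) (leg₂ A.ζ (z₀ (base A.ζ z))) (base_eq₂ A.ζ (hz₀ _).symm)) := by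
    intro z
    obtain ⟨a, ha⟩ := (s₂.gen _).exists_tmul_right (A.α z (z₀ (base A.ζ z)) (hz₀ _).symm
      (s₁.e (pt (leg₁ A.ζ z) (leg₁ A.ζ (z₀ (base A.ζ z))) (hz₀ _).symm) ⊗ₜ a₀ (base A.ζ z)))
    refine ⟨a, .of_norm_eq (hA z) ?_, ha⟩
    have := congrArg norm ha
    rw [LinearIsometryEquiv.norm_map, TensorProduct.norm_tmul, TensorProduct.norm_tmul,
      (s₁.gen _).norm_eq, (s₂.gen _).norm_eq, (ha₀ _).norm_eq, one_mul, mul_one] at this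
    exact this.symm
  choose e he he' using ex
  have spec : ∀ (m : M) (z : A.Z) (h : base A.ζ z = base A.ζ (z₀ m)), A.α z (z₀ m) h
      (s₁.e (pt (leg₁ A.ζ z) (leg₁ A.ζ (z₀ m)) h) ⊗ₜ a₀ m) =
      e z ⊗ₜ s₂.e (pt (leg₂ A.ζ z) (leg₂ A.ζ (z₀ m)) (base_eq₂ A.ζ h)) := by
    intro m z h
    obtain rfl : base A.ζ z = m := h.trans (hz₀ m)
    exact he' z
  refine ⟨⟨⟨e, he⟩, fun z z' h => ?_⟩⟩
  let m := base A.ζ z'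
  have h' : base A.ζ z' = base A.ζ (z₀ m) := (hz₀ _).symm
  -- The unknown `x` has to equal `e z`. The compatibility of `α` at `(z, z', z₀)`, evaluated on
  -- chosen vectors, gives `e z ⊗ s₂ = x ⊗ s₂` over `(z, z₀)`, and the unit vector `s₂` cancels.
  obtain ⟨x, hx⟩ := (s₂.gen (pt (leg₂ A.ζ z) (leg₂ A.ζ z') (base_eq₂ A.ζ h))).exists_tmul_right
    (A.α z z' h (s₁.e (pt (leg₁ A.ζ z) (leg₁ A.ζ z') h) ⊗ₜ e z'))
  have h1 := A.compat z z' (z₀ m) h h' (s₁.e (pt (leg₁ A.ζ z) (leg₁ A.ζ z') h))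
    (s₁.e (pt (leg₁ A.ζ z') (leg₁ A.ζ (z₀ m)) h')) (a₀ m)
  have e1 := (congrArg (fun t => A.α z (z₀ m) (h.trans h') (t ⊗ₜ a₀ m))
    (s₁.mul _ _ _ h h')).trans (spec m z (h.trans h'))
  have e2 : ∀ (F : G₁.Lf (leg₁ A.ζ z) (leg₁ A.ζ z') h ⊗[ℂ] (A.A.fib z' ⊗[ℂ]
      G₂.Lf (leg₂ A.ζ z') (leg₂ A.ζ (z₀ m)) (base_eq₂ A.ζ h')) →ₗ[ℂ]
      A.A.fib z ⊗[ℂ] G₂.Lf (leg₂ A.ζ z) (leg₂ A.ζ (z₀ m)) (base_eq₂ A.ζ (h.trans h'))), F (s₁.e (pt (leg₁ A.ζ z) (leg₁ A.ζ z') h) ⊗ₜ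
      A.α z' (z₀ m) h' (s₁.e (pt (leg₁ A.ζ z') (leg₁ A.ζ (z₀ m)) h') ⊗ₜ a₀ m)) =
      F (s₁.e (pt (leg₁ A.ζ z) (leg₁ A.ζ z') h) ⊗ₜ (e z' ⊗ₜ
        s₂.e (pt (leg₂ A.ζ z') (leg₂ A.ζ (z₀ m)) (base_eq₂ A.ζ h')))) :=
    fun F => congrArg F (congrArg _ (spec m z' h'))
  let F₁ := (LinearIsometryEquiv.lTensor (A.A.fib z)
    (G₂.μ _ _ _ (base_eq₂ A.ζ h) (base_eq₂ A.ζ h'))).toLinearEquiv.toLinearMap ∘ₗ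
      (TensorProduct.assocIsometry ℂ _ _ _).toLinearEquiv.toLinearMap
  have e3 := congrArg (fun t => F₁ (t ⊗ₜ[ℂ]
    s₂.e (pt (leg₂ A.ζ z') (leg₂ A.ζ (z₀ m)) (base_eq₂ A.ζ h')))) hx
  have e4 := congrArg (fun t => x ⊗ₜ[ℂ] t) (s₂.mul _ _ _ (base_eq₂ A.ζ h) (base_eq₂ A.ζ h'))
  have e5 := e2 (F₁ ∘ₗ (LinearIsometryEquiv.rTensor _ (A.α z z' h)).toLinearEquiv.toLinearMap ∘ₗ
    (TensorProduct.assocIsometry ℂ _ _ _).symm.toLinearEquiv.toLinearMap)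
  have e6 := ((e1.symm.trans h1).trans e5).trans (e3.trans e4)
  exact hx.trans (congrArg (fun t => t ⊗ₜ[ℂ] _) ((s₂.gen _).tmul_right_cancel e6).symm)

/-! ### The inverse of a line bundle -/

section Inv

variable {X : Mfd.{u}}

/-- The dual of a line bundle; its fibres are identified with those of `E` by means of a unit
section. -/
@[reducible] def PreBundle.inv (E : PreBundle X) (s : E.USec) : PreBundle X where
  r := E.r
  fib := E.fib
  dom := E.dom
  -- With `e` standing for its own dual vector, the frame dual to `u • e` is `u⁻¹ • e`. The fibres
  -- are those of `E`; the new frames and the opposite connection form make the bundle the dual.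
  frame p x :=
    have := s.nonempty x
    have := s.subsingleton x
    (s.gen x).basis E.r (fun b => (inner ℂ (s.e x) (E.frame p x b) : ℂ)⁻¹)
      (fun b => by rw [norm_inv, s.norm_inner_frame, inv_one])
  conn p a b x := -E.conn p a b x

/-- The unit section of the dual line bundle. -/
@[reducible] def PreBundle.USec.inv {E : PreBundle X} (s : E.USec) : (E.inv s).USec where
  e := s.e
  gen := s.gen

theorem PreBundle.USec.datum_inv {E : PreBundle X} (s : E.USec) (p : X) (b : E.r) (x₀ : X) :
    s.inv.datum p b x₀ = -s.datum p b x₀ := by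
  refine Prod.ext (funext fun x => Additive.toMul.injective (Units.ext ?_)) rfl
  have := s.nonempty x
  have := s.subsingleton x
  have h : inner ℂ (s.e x) ((E.inv s).frame p x b) =
      (inner ℂ (s.e x) (E.frame p x b) : ℂ)⁻¹ := by
    have h1 : (E.inv s).frame p x b = (inner ℂ (s.e x) (E.frame p x b) : ℂ)⁻¹ • s.e x :=
      (s.gen x).basis_apply E.r _
        (fun b => by rw [norm_inv, s.norm_inner_frame, inv_one]) b
    rw [h1, inner_smul_right, (s.gen x).inner_self, mul_one]
  simpa [PreBundle.USec.datum] using h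

theorem PreBundle.USec.cls_inv {E : PreBundle X} (s : E.USec) (x₀ : X) :
    s.inv.cls x₀ = -s.cls x₀ := by
  obtain ⟨b⟩ := s.nonempty x₀
  rw [s.cls_eq x₀ b, s.inv.cls_eq x₀ b, s.datum_inv]
  rfl

theorem PreBundle.USec.cls_inv_pull {Y : Mfd.{u}} {E : PreBundle X} (s : E.USec) (f : SMap Y X)
    (y : Y) : (s.inv.pull f).cls y = -(s.pull f).cls y := by
  rw [USec.cls_pull, USec.cls_pull, ← map_neg, ← USec.cls_inv]

/-- The dual of a hermitian line bundle with connection. -/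
@[reducible] def HBundle.inv (E : HBundle X) (s : E.USec) : HBundle X where
  toPreBundle := E.toPreBundle.inv s
  isOpen := E.isOpen
  mem := E.mem
  conn_smooth p a b := by
    have hm : ContDiff ℝ ∞ (fun c : ℂ => -c) := contDiff_neg
    exact hm.contMDiff.comp_contMDiffOn (E.conn_smooth p a b)
  conn_skew p a b x hx v := by
    have h := E.conn_skew p a b x hx v
    simp [h]
  compat := by
    rw [s.inv.isHom_iff_datum s.inv (fun _ => rfl) E.isOpen E.isOpen]
    intro p q a b x hp hq
    have h := (s.isHom_iff_datum s (φ := fun _ => LinearMap.id) (fun _ => rfl) E.isOpen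
      E.isOpen).1 E.compat p q a b x hp hq
    rw [s.datum_inv, s.datum_inv]
    -- Data change sign under duality, so the transition data of the dual are the negatives of the
    -- old ones and stay in the subgroup.
    convert neg_mem h using 1
    abel

theorem extD_neg (θ : ∀ x, X.T x →L[ℝ] ℂ) (x : X) (v w : X.T x) :
    extD (fun x => -θ x) x v w = -extD θ x v w := by
  let η : X.E → X.E →L[ℝ] ℂ := fun c =>
    (θ ((extChartAt X.I x).symm c)).comp (mfderiv 𝓘(ℝ, X.E) X.I (extChartAt X.I x).symm c)
  have h : ∀ v' w' : X.E, fderiv ℝ (fun c => -η c) (extChartAt X.I x x) v' w' =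
      -fderiv ℝ η (extChartAt X.I x x) v' w' := by
    intro v' w'
    rw [fderiv_fun_neg]
    rfl
  refine (congrArg₂ (· - ·) (h _ _) (h _ _)).trans ?_
  exact neg_sub_neg _ _ |>.trans (neg_sub _ _).symm

/-- In rank one the term `ω ∧ ω` vanishes, so the curvature is linear in the connection form. -/
theorem HBundle.trCurv_inv (E : HBundle X) (s : E.USec) (x : X) (v w : X.T x) :
    (E.inv s).trCurv x v w = -E.trCurv x v w := by
  have := s.subsingleton x
  rw [trCurv, trCurv, ← mul_neg, ← Finset.sum_neg_distrib]
  congr 1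
  refine Finset.sum_congr rfl fun a _ => ?_
  rw [curvMatrix, curvMatrix, Fintype.sum_subsingleton _ a, Fintype.sum_subsingleton _ a]
  have := extD_neg (E.conn x a a) x v w
  refine (congrArg₂ (· + ·) this ?_).trans (neg_add _ _).symm
  ring

end Inv

end

section

open PreBundle Fib

variable {M : Mfd.{u}} {G₁ G₂ : Gerbe M}

/-! ### Classes of the bundles of gerbes and 1-morphisms -/

theorem PreBundle.USec.cls_tensor_pull {X Y V W : Mfd.{u}} {E : PreBundle V} {F : PreBundle W}
    (s : E.USec) (t : F.USec) (a : SMap Y V) (b : SMap Y W) (f : SMap X Y) (x : X) :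
    (((s.pull a).tensor (t.pull b)).pull f).cls x =
      (s.pull (a.comp f)).cls x + (t.pull (b.comp f)).cls x := by
  rw [cls_pull, cls_tensor, map_add, cls_pull_comp, cls_pull_comp]

/-- The regularity of `μ`, read as a cocycle identity for classes. Arbitrary test maps `y₁, y₂, y₃`
replace the projections of `Y ×_M Y ×_M Y`, so that the identity can be specialised, for instance to
the diagonal. -/
theorem Gerbe.FlatSec.cls_mul {G : Gerbe M} (s : G.FlatSec) {X : Mfd.{u}} (y₁ y₂ y₃ : SMap X G.Y)
    (h₁₂ : ∀ t, G.π (y₁ t) = G.π (y₂ t)) (h₂₃ : ∀ t, G.π (y₂ t) = G.π (y₃ t)) (x : X) :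
    (s.toUSec.pull (lift y₁ y₂ h₁₂)).cls x + (s.toUSec.pull (lift y₂ y₃ h₂₃)).cls x =
      (s.toUSec.pull (lift y₁ y₃ fun t => (h₁₂ t).trans (h₂₃ t))).cls x := by
  let k : SMap X (Triple G.π) := lift (lift y₁ y₂ h₁₂) y₃ fun t => (h₁₂ t).trans (h₂₃ t)
  have h := (HBundle.isHom_iff (E := (G.L.pull (p₁₂ G.π)).tensor (G.L.pull (p₂₃ G.π)))
    (F := G.L.pull (p₁₃ G.π)) ((s.toUSec.pull _).tensor (s.toUSec.pull _)) (s.toUSec.pull _)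
    (φ := fun q => (G.μ (pr₁ _ _ (pr₁ _ _ q)) (pr₂ _ _ (pr₁ _ _ q)) (pr₂ _ _ q)
      (sq _ _ (pr₁ _ _ q)) (sq _ _ (p₂₃ G.π q))).toLinearEquiv.toLinearMap)
    (fun q => s.mul _ _ _ _ _)).1 G.μ_hom (k x)
  have h' := congrArg (pullClass k x) h
  rw [USec.cls_tensor, map_add, ← USec.cls_pull_comp, ← USec.cls_pull_comp,
    ← USec.cls_pull_comp] at h'
  exact h'

/-- On the diagonal the cocycle identity reads `c + c = c`. This is the counterpart for classes of
the trivialization `t_μ`. -/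
theorem Gerbe.FlatSec.cls_diag {G : Gerbe M} (s : G.FlatSec) {X : Mfd.{u}} (y y' : SMap X G.Y)
    (h : y = y') (hπ : ∀ t, G.π (y t) = G.π (y' t)) (x : X) :
    (s.toUSec.pull (lift y y' hπ)).cls x = 0 := by
  subst h
  exact (eq_sub_of_add_eq (s.cls_mul y y y (fun _ => rfl) (fun _ => rfl) x)).trans (sub_self _)

/-- The regularity of `α`, pulled back along arbitrary test maps; it supplies the class identities
for the dual 1-morphism and for both 2-isomorphisms. -/
theorem OneMor.cls_map (A : OneMor G₁ G₂) {s₁ : G₁.FlatSec} {s₂ : G₂.FlatSec}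
    (s : A.toPreOneMor.FlatSec s₁ s₂) {X : Mfd.{u}} (a b : SMap X A.Z)
    (h : ∀ t, base A.ζ (a t) = base A.ζ (b t)) (x : X) :
    (s₁.toUSec.pull (lift ((leg₁ A.ζ).toSMap.comp a) ((leg₁ A.ζ).toSMap.comp b) h)).cls x +
      (s.toUSec.pull b).cls x = (s.toUSec.pull a).cls x +
      (s₂.toUSec.pull (lift ((leg₂ A.ζ).toSMap.comp a) ((leg₂ A.ζ).toSMap.comp b)
        fun t => base_eq₂ A.ζ (h t))).cls x := by
  let k : SMap X (Fib (base A.ζ) (base A.ζ)) := lift a b h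
  have e := (HBundle.isHom_iff
    (E := (G₁.L.pull (pair₁ A.ζ)).tensor (A.A.pull (pr₂ (base A.ζ) (base A.ζ))))
    (F := (A.A.pull (pr₁ (base A.ζ) (base A.ζ))).tensor (G₂.L.pull (pair₂ A.ζ)))
    ((s₁.toUSec.pull _).tensor (s.toUSec.pull _)) ((s.toUSec.pull _).tensor (s₂.toUSec.pull _))
    (φ := fun q => (A.α (pr₁ _ _ q) (pr₂ _ _ q) (sq _ _ q)).toLinearEquiv.toLinearMap)
    (fun q => s.map _ _ _)).1 A.α_hom (k x)
  have h' := congrArg (pullClass k x) e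
  rw [USec.cls_tensor, USec.cls_tensor, map_add, map_add, ← USec.cls_pull_comp,
    ← USec.cls_pull_comp, ← USec.cls_pull_comp, ← USec.cls_pull_comp] at h'
  exact h'

/-! ### The inverse 1-morphism -/

/-- The flip of a fibre product, as a surjective submersion. -/
def Fib.flip {X Y N : Mfd.{u}} (f : SSub X N) (g : SSub Y N) : SSub (Fib f g) (Fib g f) where
  toSMap := Fib.swap f g
  surj q := ⟨Fib.swap g f q, rfl⟩
  subm q := submersion_of_section (Fib.swap f g) q (Fib.swap g f) ((Fib.swap g f).smooth _) rfl
    (Filter.Eventually.of_forall fun _ => rfl)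

namespace PreOneMor

variable {s₁ : G₁.FlatSec} {s₂ : G₂.FlatSec}

/-- The dual of a 1-morphism given by a line bundle. -/
@[reducible] def inv (A : PreOneMor G₁ G₂) (s : A.FlatSec s₁ s₂) : PreOneMor G₂ G₁ where
  Z := A.Z
  ζ := (Fib.flip _ _).comp A.ζ
  A := A.A.inv s.toUSec
  -- Prescribed on generators only; smoothness and parallelism are established afterwards through
  -- classes.
  α z z' _ := ((s₂.gen _).tmul (s.gen z')).equiv ((s.gen z).tmul (s₁.gen _))

/-- The flat section of the dual 1-morphism. -/
@[reducible] def FlatSec.inv {A : PreOneMor G₁ G₂} (s : A.FlatSec s₁ s₂) :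
    (A.inv s).FlatSec s₂ s₁ where
  e := s.e
  gen := s.gen
  map _ _ _ := IsUnitGen.equiv_apply _ _

/-- A flat section forces the compatibility of `α` with the gerbe multiplications. -/
theorem FlatSec.compat {A : PreOneMor G₁ G₂} (s : A.FlatSec s₁ s₂) (z₁ z₂ z₃ : A.Z)
    (h₁₂ : base A.ζ z₁ = base A.ζ z₂) (h₂₃ : base A.ζ z₂ = base A.ζ z₃)
    (l : G₁.Lf (leg₁ A.ζ z₁) (leg₁ A.ζ z₂) h₁₂) (l' : G₁.Lf (leg₁ A.ζ z₂) (leg₁ A.ζ z₃) h₂₃)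
    (a : A.A.fib z₃) :
    A.α z₁ z₃ (h₁₂.trans h₂₃) (G₁.μ _ _ _ h₁₂ h₂₃ (l ⊗ₜ l') ⊗ₜ a) =
      LinearIsometryEquiv.lTensor (A.A.fib z₁) (G₂.μ _ _ _ (base_eq₂ A.ζ h₁₂) (base_eq₂ A.ζ h₂₃))
        (TensorProduct.assocIsometry ℂ _ _ _
          (LinearIsometryEquiv.rTensor _ (A.α z₁ z₂ h₁₂)
            ((TensorProduct.assocIsometry ℂ _ _ _).symm (l ⊗ₜ A.α z₂ z₃ h₂₃ (l' ⊗ₜ a))))) := by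
  let P := (A.α z₁ z₃ (h₁₂.trans h₂₃)).toLinearEquiv.toLinearMap ∘ₗ
    (LinearIsometryEquiv.rTensor (A.A.fib z₃) (G₁.μ _ _ _ h₁₂ h₂₃)).toLinearEquiv.toLinearMap
  let R := (LinearIsometryEquiv.lTensor (A.A.fib z₁)
      (G₂.μ _ _ _ (base_eq₂ A.ζ h₁₂) (base_eq₂ A.ζ h₂₃))).toLinearEquiv.toLinearMap ∘ₗ
    (TensorProduct.assocIsometry ℂ _ _ _).toLinearEquiv.toLinearMap ∘ₗ
    (LinearIsometryEquiv.rTensor _ (A.α z₁ z₂ h₁₂)).toLinearEquiv.toLinearMap ∘ₗ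
    (TensorProduct.assocIsometry ℂ _ _ _).symm.toLinearEquiv.toLinearMap
  let Q := R ∘ₗ (LinearIsometryEquiv.lTensor _ (A.α z₂ z₃ h₂₃)).toLinearEquiv.toLinearMap ∘ₗ
    (TensorProduct.assocIsometry ℂ _ _ _).toLinearEquiv.toLinearMap
  have key : P = Q := by
    -- The source `L₁ ⊗ L₁ ⊗ A` is a line, and on its generator both sides equal `e z₁ ⊗ s₂`.
    refine (((s₁.gen (pt _ _ h₁₂)).tmul (s₁.gen (pt _ _ h₂₃))).tmul (s.gen z₃)).hom_ext ?_
    have e1 := (congrArg (fun t => A.α z₁ z₃ (h₁₂.trans h₂₃) (t ⊗ₜ s.e z₃))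
      (s₁.mul _ _ _ h₁₂ h₂₃)).trans (s.map z₁ z₃ (h₁₂.trans h₂₃))
    have e2 := congrArg (fun t => R (s₁.e (pt _ _ h₁₂) ⊗ₜ[ℂ] t)) (s.map z₂ z₃ h₂₃)
    have e3 := congrArg (fun t => LinearIsometryEquiv.lTensor (A.A.fib z₁)
      (G₂.μ _ _ _ (base_eq₂ A.ζ h₁₂) (base_eq₂ A.ζ h₂₃)) (TensorProduct.assocIsometry ℂ _ _ _
        (t ⊗ₜ[ℂ] s₂.e (pt _ _ (base_eq₂ A.ζ h₂₃))))) (s.map z₁ z₂ h₁₂)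
    have e4 := congrArg (fun t => s.e z₁ ⊗ₜ[ℂ] t)
      (s₂.mul _ _ _ (base_eq₂ A.ζ h₁₂) (base_eq₂ A.ζ h₂₃))
    exact e1.trans (e2.trans (e3.trans e4)).symm
  exact LinearMap.congr_fun key ((l ⊗ₜ l') ⊗ₜ a)

end PreOneMor

/-! ### Invertibility from a flat section, and the rank of an invertible 1-morphism -/

namespace OneMor

variable {s₁ : G₁.FlatSec} {s₂ : G₂.FlatSec}

/-- The inverse of a 1-morphism given by a line bundle. -/
@[reducible] def inv (A : OneMor G₁ G₂) (s : A.toPreOneMor.FlatSec s₁ s₂) : OneMor G₂ G₁ where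
  toPreOneMor := A.toPreOneMor.inv s
  rank_pos := A.rank_pos
  α_hom := by
    let B := A.toPreOneMor.inv s
    refine (HBundle.isHom_iff
      (E := (G₂.L.pull (pair₁ B.ζ)).tensor (B.A.pull (pr₂ (base B.ζ) (base B.ζ))))
      (F := (B.A.pull (pr₁ (base B.ζ) (base B.ζ))).tensor (G₁.L.pull (pair₂ B.ζ)))
      ((s₂.toUSec.pull _).tensor (s.inv.toUSec.pull _))
      ((s.inv.toUSec.pull _).tensor (s₁.toUSec.pull _))
      (φ := fun q => (B.α (pr₁ _ _ q) (pr₂ _ _ q) (sq _ _ q)).toLinearEquiv.toLinearMap)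
      (fun q => s.inv.map _ _ _)).2 fun q => ?_
    -- The projection of `B` to `M` runs through `Y₂`, that of `A` through `Y₁`; they agree on
    -- points.
    have hb : ∀ q : Fib (base B.ζ) (base B.ζ), base A.ζ (pr₁ _ _ q) = base A.ζ (pr₂ _ _ q) :=
      fun q => (base_eq A.ζ _).trans ((sq _ _ q).trans (base_eq A.ζ _).symm)
    have h := A.cls_map s (pr₁ (base B.ζ) (base B.ζ)) (pr₂ (base B.ζ) (base B.ζ)) hb q
    have n1 : (s.inv.toUSec.pull (pr₁ (base B.ζ) (base B.ζ))).cls q =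
        -(s.toUSec.pull (pr₁ (base B.ζ) (base B.ζ))).cls q := s.toUSec.cls_inv_pull _ q
    have n2 : (s.inv.toUSec.pull (pr₂ (base B.ζ) (base B.ζ))).cls q =
        -(s.toUSec.pull (pr₂ (base B.ζ) (base B.ζ))).cls q := s.toUSec.cls_inv_pull _ q
    -- The required identity `L₂ - A_b = -A_a + L₁` of classes is `OneMor.cls_map`, `L₁ + A_b = A_a
    -- + L₂`, rearranged.
    rw [USec.cls_tensor, USec.cls_tensor, n1, n2, ← sub_eq_add_neg, sub_eq_iff_eq_add,
      neg_add_eq_sub, sub_add_eq_add_sub, eq_sub_iff_add_eq]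
    exact (add_comm _ _).trans h.symm
  curv z v w := by
    have h := A.curv z v w
    have h2 := A.A.trCurv_inv s.toUSec z v w
    have h3 : (1 / (A.A.rank : ℂ)) * (A.A.inv s.toUSec).trCurv z v w =
        ((G₁.C.pullAt (leg₁ A.ζ).toSMap z v w - G₂.C.pullAt (leg₂ A.ζ).toSMap z v w : ℝ) : ℂ) := by
      rw [h2, mul_neg, h, ← Complex.ofReal_neg, neg_sub]
    exact h3
  compat := s.inv.compat

theorem isInvertible_of_flatSec (A : OneMor G₁ G₂) (s : A.toPreOneMor.FlatSec s₁ s₂) :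
    A.IsInvertible := by
  let B := A.inv s
  have hinv : ∀ {X : Mfd.{u}} (f : SMap X A.Z) (x : X),
      (s.inv.toUSec.pull f).cls x = -(s.toUSec.pull f).cls x := s.toUSec.cls_inv_pull
  let tl := s.inv.comp s
  let tr := s.comp s.inv
  let i₁ := PreOneMor.FlatSec.id s₁
  let i₂ := PreOneMor.FlatSec.id s₂
  refine ⟨B, .ofSec tl.toUSec i₁.toUSec, .ofSec i₂.toUSec tr.toUSec,
    PreTwoMor.isIso_ofSec tl i₁ fun w => ?_, PreTwoMor.isIso_ofSec i₂ tr fun w => ?_, ?_⟩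
  -- For `il`: the points `a`, `b` of `Z` lie over the same point of `Y₂`, so `L₂` contributes zero
  -- by `cls_diag` and the class of `A_a ⊗ A_b*` is that of `L₁`.
  · let C := B.toPreOneMor.comp A.toPreOneMor
    let I := PreOneMor.id G₁
    let a : SMap (Fib C.ζ I.ζ) A.Z := (pr₁ (leg₂ A.ζ) (leg₁ B.ζ)).comp (pr₁ C.ζ I.ζ)
    let b : SMap (Fib C.ζ I.ζ) A.Z := (pr₂ (leg₂ A.ζ) (leg₁ B.ζ)).comp (pr₁ C.ζ I.ζ)
    have h₂ : ∀ t, leg₂ A.ζ (a t) = leg₂ A.ζ (b t) := fun t => sq _ _ (pr₁ C.ζ I.ζ t)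
    have hM : ∀ t, base A.ζ (a t) = base A.ζ (b t) := fun t => base_eq_of_leg₂ A.ζ (h₂ t)
    have h := A.cls_map s a b hM w
    have hd := s₂.cls_diag ((leg₂ A.ζ).toSMap.comp a) ((leg₂ A.ζ).toSMap.comp b)
      (SMap.ext h₂) (fun t => base_eq₂ A.ζ (hM t)) w
    have hl : pr₂ C.ζ I.ζ = lift ((leg₁ A.ζ).toSMap.comp a) ((leg₁ A.ζ).toSMap.comp b) hM :=
      SMap.ext fun t => (sq C.ζ I.ζ t).symm
    have h' := h.trans ((congrArg ((s.toUSec.pull a).cls w + ·) hd).trans (add_zero _))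
    refine (USec.cls_tensor_pull s.toUSec s.inv.toUSec (pr₁ (leg₂ A.ζ) (leg₁ B.ζ))
      (pr₂ (leg₂ A.ζ) (leg₁ B.ζ)) (pr₁ C.ζ I.ζ) w).trans ?_
    rw [hl, hinv, ← sub_eq_add_neg, sub_eq_iff_eq_add]
    exact h'.symm
  -- For `ir`: now `a` and `b` share their point of `Y₁`, so `L₁` contributes zero and the class of
  -- `A_a* ⊗ A_b` is that of `L₂`.
  · let C := A.toPreOneMor.comp B.toPreOneMor
    let I := PreOneMor.id G₂
    let a : SMap (Fib I.ζ C.ζ) A.Z := (pr₁ (leg₂ B.ζ) (leg₁ A.ζ)).comp (pr₂ I.ζ C.ζ)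
    let b : SMap (Fib I.ζ C.ζ) A.Z := (pr₂ (leg₂ B.ζ) (leg₁ A.ζ)).comp (pr₂ I.ζ C.ζ)
    have h₁ : ∀ t, leg₁ A.ζ (a t) = leg₁ A.ζ (b t) := fun t => sq _ _ (pr₂ I.ζ C.ζ t)
    have hM : ∀ t, base A.ζ (a t) = base A.ζ (b t) := fun t => congrArg G₁.π (h₁ t)
    have h := A.cls_map s a b hM w
    have hd := s₁.cls_diag ((leg₁ A.ζ).toSMap.comp a) ((leg₁ A.ζ).toSMap.comp b)
      (SMap.ext h₁) hM w
    have hl : pr₁ I.ζ C.ζ = lift ((leg₂ A.ζ).toSMap.comp a) ((leg₂ A.ζ).toSMap.comp b)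
        (fun t => base_eq₂ A.ζ (hM t)) := SMap.ext fun t => sq I.ζ C.ζ t
    have h' := ((congrArg (· + (s.toUSec.pull b).cls w) hd).trans (zero_add _)).symm.trans h
    refine Eq.trans ?_ (USec.cls_tensor_pull s.inv.toUSec s.toUSec (pr₁ (leg₂ B.ζ) (leg₁ A.ζ))
      (pr₂ (leg₂ B.ζ) (leg₁ A.ζ)) (pr₂ I.ζ C.ζ) w).symm
    rw [hl, hinv, ← sub_eq_neg_add, eq_sub_iff_add_eq]
    exact (add_comm _ _).trans h'.symm
  -- Zigzag identity: each factor matches the flat sections, hence so does the composite, and `ρ_A`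
  -- matches the same pair.
  · have f1 : ((PreTwoMor.ofSec i₂.toUSec tr.toUSec).hcomp
        (PreTwoMor.id A.toPreOneMor)).Flat (i₂.comp s).toUSec (tr.comp s).toUSec :=
      PreTwoMor.Flat.hcomp (PreTwoMor.Flat.ofSec _ _) (PreTwoMor.Flat.id s)
    have f2 := PreTwoMor.Flat.assoc s s.inv s
    have f3 : ((PreTwoMor.id A.toPreOneMor).hcomp
        (PreTwoMor.ofSec tl.toUSec i₁.toUSec)).Flat (s.comp tl).toUSec (s.comp i₁).toUSec :=
      PreTwoMor.Flat.hcomp (PreTwoMor.Flat.id s) (PreTwoMor.Flat.ofSec _ _)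
    have f4 := PreTwoMor.Flat.lam s
    exact (f4.vcomp (f3.vcomp (f2.vcomp f1))).equiv (PreTwoMor.Flat.rho s)

/-- Only the existence of a fibrewise injective map from `A ⊗ B` to the line bundle `L₁` is used: it
bounds the product of two positive ranks by 1. -/
theorem IsInvertible.hasRank {A : OneMor G₁ G₂} (h : A.IsInvertible) : A.A.HasRank 1 := by
  obtain ⟨B, il, -, -⟩ := h
  intro x
  -- The rank does not depend on the point, because one index type serves all frames; `x` only
  -- guarantees that the domain of `il` has a point at which to compare dimensions.
  obtain ⟨p, -⟩ := (fst (leg₂ A.ζ) (leg₁ B.ζ)).surj x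
  obtain ⟨w, -⟩ := il.zA.surj p
  have h1 := LinearMap.finrank_le_finrank_of_injective (f := (il.β w).toLinearMap)
    (il.β w).injective
  have hr : ∀ {X : Mfd.{u}} (E : HBundle X) (y : X), Module.finrank ℂ (E.fib y) = E.rank :=
    fun E y => Module.finrank_eq_card_basis (E.frame y y).toBasis
  have h2 : A.A.rank * B.A.rank ≤ G₁.L.rank := by
    rw [← hr G₁.L (pr₂ _ _ (il.sub w)), ← hr A.A (pr₁ _ _ (pr₁ _ _ (il.sub w))),
      ← hr B.A (pr₂ _ _ (pr₁ _ _ (il.sub w))), ← Module.finrank_tensorProduct]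
    exact h1
  rw [G₁.rank_L] at h2
  rw [hr]
  have h3 := A.rank_pos
  have h4 := B.rank_pos
  nlinarith

end OneMor

end

end

end BundleGerbes

theorem proposition3 {M : BundleGerbes.Mfd.{u}} {G₁ G₂ : BundleGerbes.Gerbe M}
    (A : BundleGerbes.OneMor G₁ G₂) :
    A.IsInvertible ↔ A.A.HasRank 1 := by
  refine ⟨BundleGerbes.OneMor.IsInvertible.hasRank, fun h => ?_⟩
  obtain ⟨s₁⟩ := G₁.exists_flatSec
  obtain ⟨s₂⟩ := G₂.exists_flatSec
  obtain ⟨s⟩ := A.exists_flatSec h s₁ s₂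
  exact A.isInvertible_of_flatSec s
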